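/- **Setting.** A *graph problem* $\Pi$ consists of a (possibly infinite) set $\Gamma$ of output labels and, for every finite simple graph $G=(V,E)$, a set $\Pi(G)\subseteq\Gamma^V$ of solutions. It is *isomorphism-invariant* if $\Pi(G)=\{\sigma\circ\alpha:\sigma\in\Pi(H)\}$ for every isomorphism $\alpha$ from $G$ to $H$, and *component-wise* if $\sigma\in\Pi(G)$ holds exactly when the restriction of $\sigma$ to each connected component $H$ of $G$ belongs to $\Pi(H)$. Let $\mathsf{ALL}$ be the class of isomorphism-invariant, component-wise graph problems. An event holds *a.a.s.* if its probability for the uniformly random graph $G(n,1/2)$ on $n$ labeled nodes tends to $1$ as $n\to\infty$. In a *non-uniform $\mathsf{MB}$ algorithm* all nodes of the input graph run the same deterministic algorithm without identifiers. Initially each node knows its degree and the number $n$ of nodes. In each synchronous round every node that has not halted broadcasts one message to all its neighbors, receives the multiset of the messages broadcast by its neighbors, and updates its state. A node that enters a stopping state halts with an output in $\Gamma\cup\{\mathtt{failed}\}$, where $\mathtt{failed}\notin\Gamma$. A *non-uniform $\mathsf{SB}$ algorithm* is the same, except that a node receives only the set of these messages, without multiplicities. Local computation and message size are unrestricted. Such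 an algorithm $\mathcal A$ *runs in $r$ rounds* if on every finite graph all nodes halt within $r$ rounds; $\mathcal A(G)$ denotes the output labeling. It is *sound* for $\Pi$ if $\mathcal A(G)\in\Pi(G)$ a.a.s. and, for every finite graph $G$ with $\mathcal A(G)\notin\Pi(G)$, all nodes of $G$ output $\mathtt{failed}$. For $\mathsf M\in\{\mathsf{SB},\mathsf{MB}\}$ let $\mathsf M_{n\text{-snd}}[r]$ be the class of problems in $\mathsf{ALL}$ that admit a sound non-uniform $\mathsf M$ algorithm running in $r$ rounds. Let $\mathsf{ALL}^+$ be the class of those $\Pi\in\mathsf{ALL}$ for which a.a.s. $\Pi(G)\neq\emptyset$. **Theorem.** 1. $\mathsf{ALL}^+=\mathsf{SB}_{n\text{-snd}}[4]$; that is, every isomorphism-invariant, component-wise graph problem that a.a.s. has a solution is solvable by a sound non-uniform $\mathsf{SB}$ algorithm in $4$ rounds. 2. $\mathsf{MB}_{n\text{-snd}}[3]\subsetneq\mathsf{ALL}^+$. Moreover, there is a problem $\Pi\in\mathsf{ALL}$ with $\Pi(G)\ne\emptyset$ for every finite graph $G$ such that $\Pi\notin\mathsf{MB}_{n\text{-snd}}[3]$.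 -/

import Mathlib

open Filter Topology

/-- A graph problem: a set `Label` of output labels and, for every finite simple graph `G` with
vertex set `V`, a set of solutions, each of them a labeling `V → Label`. -/
structure GraphProblem where
  Label : Type
  solutions : ∀ {V : Type} [Finite V], SimpleGraph V → Set (V → Label)

namespace GraphProblem

/-- The solutions of `G` are the solutions of `H` pulled back along any isomorphism. -/
def IsomorphismInvariant (P : GraphProblem) : Prop :=
  ∀ (V W : Type) [Finite V] [Finite W] (G : SimpleGraph V) (H : SimpleGraph W) (α : G ≃g H),
    P.solutions G = {τ | ∃ σ ∈ P.solutions H, τ = σ ∘ α}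

/-- A labeling is a solution iff its restriction to every connected component is one. -/
def ComponentWise (P : GraphProblem) : Prop :=
  ∀ (V : Type) [Finite V] (G : SimpleGraph V) (σ : V → P.Label),
    σ ∈ P.solutions G ↔
      ∀ c : G.ConnectedComponent,
        (fun u : c.supp => σ u) ∈ P.solutions (G.induce c.supp)

end GraphProblem

/-- The class of all isomorphism-invariant, component-wise graph problems. -/
def ALL : Set GraphProblem :=
  {P | P.IsomorphismInvariant ∧ P.ComponentWise}

/-- The probability that the random graph `G(n, 1/2)` satisfies `E`. -/
noncomputable def randomGraphProb (n : ℕ) (E : SimpleGraph (Fin n) → Prop) : ℝ :=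
  (SimpleGraph.binomialRandom (Fin n) ⟨1 / 2, by norm_num, by norm_num⟩).real {G | E G}

/-- A property of graphs holds asymptotically almost surely for `G(n, 1/2)`. -/
def AAS (E : ∀ n : ℕ, SimpleGraph (Fin n) → Prop) : Prop :=
  Tendsto (fun n => randomGraphProb n (E n)) atTop (𝓝 1)

/-- A broadcast model is given by what a node gets to see of the multiset of the messages that its
neighbors broadcast in a round. -/
structure BroadcastModel where
  Inbox : Type → Type
  receive : ∀ {M : Type}, Multiset M → Inbox M

/-- Multiset-broadcast: the whole multiset is received. -/
def MB : BroadcastModel where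
  Inbox := Multiset
  receive := fun m => m

/-- Set-broadcast: only the set of messages is received, without multiplicities. -/
def SB : BroadcastModel where
  Inbox := Set
  receive := fun m => {x | x ∈ m}

/-- The final output of a node: a label, or the special value `failed`. -/
inductive NodeOutput (Γ : Type) where
  | label (x : Γ)
  | failed

/-- A deterministic anonymous non-uniform algorithm. All nodes run the same algorithm. There is no
restriction on local computation or on the size of messages. -/
structure Algorithm (M : BroadcastModel) (Γ : Type) where
  State : Type
  Msg : Type
  /-- initial state of a node, from the number `n` of nodes and the degree of the node -/
  init : (n : ℕ) → (deg : ℕ) → State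
  /-- the message broadcast by a node that has not halted -/
  send : State → Msg
  /-- the new state of a node that has not halted -/
  update : State → M.Inbox Msg → State
  /-- `some o` for a stopping state with output `o`, `none` for a non-stopping state -/
  output : State → Option (NodeOutput Γ)

namespace Algorithm

variable {M : BroadcastModel} {Γ : Type}

/-- What a node in state `s` broadcasts. A halted node is silent. -/
def outgoing (A : Algorithm M Γ) (s : A.State) : Option A.Msg :=
  match A.output s with
  | none => some (A.send s)
  | some _ => none

open Classical in
/-- The state of node `v` after `r` synchronous rounds on the input graph `G`. -/
noncomputable def stateAfter (A : Algorithm M Γ) {V : Type} [Fintype V] (G : SimpleGraph V) :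
    ℕ → V → A.State
  | 0, v => A.init (Fintype.card V) (G.degree v)
  | r + 1, v =>
    match A.output (A.stateAfter G r v) with
    | some _ => A.stateAfter G r v
    | none =>
      A.update (A.stateAfter G r v)
        (M.receive ((G.neighborFinset v).val.filterMap
          (fun u => A.outgoing (A.stateAfter G r u))))

/-- On `G`, all nodes halt within `r` rounds, and `τ` is the labeling that they output. -/
def OutputsWithin (A : Algorithm M Γ) {V : Type} [Fintype V] (G : SimpleGraph V) (r : ℕ)
    (τ : V → NodeOutput Γ) : Prop :=
  ∀ v, A.output (A.stateAfter G r v) = some (τ v)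

/-- On `G`, all nodes halt within `r` rounds, and the output is a solution of `P`. -/
def SolvesOn {P : GraphProblem} (A : Algorithm M P.Label) {V : Type} [Fintype V]
    (G : SimpleGraph V) (r : ℕ) : Prop :=
  ∃ σ ∈ P.solutions G, A.OutputsWithin G r (fun v => NodeOutput.label (σ v))

/-- `A` is a sound algorithm for `P` that runs in (at most) `r` rounds: on every graph all nodes
halt within `r` rounds; the output is a solution asymptotically almost surely on `G(n, 1/2)`; and
whenever the output is not a solution, all nodes output `failed`. -/
structure IsSound {P : GraphProblem} (A : Algorithm M P.Label) (r : ℕ) : Prop where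
  halts : ∀ (V : Type) [Fintype V] (G : SimpleGraph V), ∃ τ, A.OutputsWithin G r τ
  solves : AAS (fun _ G => A.SolvesOn G r)
  failed_of_not_solved : ∀ (V : Type) [Fintype V] (G : SimpleGraph V),
    ¬ A.SolvesOn G r → A.OutputsWithin G r (fun _ => NodeOutput.failed)

end Algorithm

/-- The class of problems solvable in model `M` by non-uniform sound algorithms in `r` rounds. -/
def nonuniformSound (M : BroadcastModel) (r : ℕ) : Set GraphProblem :=
  {P | P ∈ ALL ∧ ∃ A : Algorithm M P.Label, A.IsSound r}

/-- The problems in `ALL` that have a solution on almost all graphs. -/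
def solvableALL : Set GraphProblem :=
  {P | P ∈ ALL ∧ AAS (fun _ G => (P.solutions G).Nonempty)}

/-! Part 1 rests on naming: the name of a vertex is the set of the degrees of its neighbors. Two
rounds give a vertex its own name and those of its neighbors; two more bring it these records for
all ends of walks of length two. Almost surely any two vertices have a common neighbor and all names
differ (`aas_hasCommonNeighbors`, `aas_neighborDegrees_injective`), so every vertex reconstructs the
same named copy of the graph and reads its output off the same chosen solution. Knowing `n` makes
this checkable: `n` different names prove that the names are distinct and that no record is missing,
and the common-neighbor test on the copy proves that all other vertices see just as much. Hence
either all vertices succeed or all fail.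

Why names differ: put x = n^(1/20). Beyond a suitable threshold in the upper tail of the degree
distribution there are many vertices, although each single degree is expected o(1) times
(`exists_binomial_threshold`). First and second moments then give at least x vertices whose degree
is at distance 6 or more from every other degree. For given u and v, removing both shifts degrees by
at most 2, so such vertices stay recognizable by degree whatever the edges at u are. Equal names
force u and v to agree on all but two of them, which for fixed exceptions has probability at most
2^(4 - x); this beats the n^4 choices of u, v and the exceptions.

Part 2 uses the problem of naming the isomorphism type of one's component. Three rounds reveal to v
the edges that meet its closed neighborhood and otherwise only the neighbor-degree multisets
(`Algorithm.stateAfter_three_eq`). Almost surely all degrees lie in a window of size O(n^(11/20)),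
so the multisets carry O(n^(31/20) log n) bits and relabeling accounts for O(n log n) more, while
the pairs inside the at least n/4 non-neighbors of v hide order n^2 bits. Thus fewer than half of
all graphs can be recognized (`card_mul_le_of_view`, `eventually_view_bound_lt`), in any broadcast
model. -/

/-! ### Uniform probability on a finite type -/

open Classical in
/-- The proportion of the elements of a finite type that satisfy `E`. -/
noncomputable def pr {Ω : Type*} [Fintype Ω] (E : Ω → Prop) : ℝ :=
  (Finset.univ.filter E).card / Fintype.card Ω

lemma pr_def {Ω : Type*} [Fintype Ω] (E : Ω → Prop) [DecidablePred E] :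
    pr E = (Finset.univ.filter E).card / Fintype.card Ω := by
  unfold pr
  congr!

section UniformProbability

variable {Ω : Type*} [Fintype Ω]

lemma pr_nonneg (E : Ω → Prop) : 0 ≤ pr E := by unfold pr; positivity

lemma pr_mono {E F : Ω → Prop} (h : ∀ ω, E ω → F ω) : pr E ≤ pr F := by
  classical
  simp only [pr_def]
  gcongr
  exact h _

lemma pr_or_le (E F : Ω → Prop) : pr (fun ω => E ω ∨ F ω) ≤ pr E + pr F := by
  classical
  simp only [pr_def]
  rw [← add_div, Finset.filter_or]
  gcongr
  exact_mod_cast Finset.card_union_le _ _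

lemma pr_exists_le {ι : Type*} [Fintype ι] (E : ι → Ω → Prop) :
    pr (fun ω => ∃ i, E i ω) ≤ ∑ i, pr (E i) := by
  classical
  simp only [pr_def]
  rw [← Finset.sum_div]
  gcongr
  have : (Finset.univ.filter fun ω => ∃ i, E i ω)
      ⊆ Finset.univ.biUnion fun i => Finset.univ.filter (E i) := by
    intro ω; simp
  exact_mod_cast (Finset.card_le_card this).trans Finset.card_biUnion_le

lemma pr_exists_le_card_mul {ι : Type*} [Fintype ι] (E : ι → Ω → Prop) {c : ℝ}
    (h : ∀ i, pr (E i) ≤ c) : pr (fun ω => ∃ i, E i ω) ≤ Fintype.card ι * c :=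
  (pr_exists_le E).trans ((Finset.sum_le_sum fun i _ => h i).trans (by simp))

variable [Nonempty Ω]

lemma pr_not (E : Ω → Prop) : pr (fun ω => ¬ E ω) = 1 - pr E := by
  classical
  simp only [pr_def]
  have h : (Fintype.card Ω : ℝ) ≠ 0 := by simp
  have h2 := Finset.card_filter_add_card_filter_not (s := (Finset.univ : Finset Ω)) E
  rw [eq_sub_iff_add_eq, ← add_div, div_eq_one_iff_eq h, add_comm, ← Finset.card_univ, ← h2]
  push_cast
  rfl

/-- A map all of whose fibers have the same size preserves the uniform probability. -/
lemma pr_comp_of_fiber_injections {T : Type*} [Fintype T] (f : Ω → T)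
    (h : ∀ t t', ∃ e : Ω → Ω, Function.Injective e ∧ ∀ ω, f ω = t → f (e ω) = t')
    (Q : T → Prop) : pr (fun ω => Q (f ω)) = pr Q := by
  classical
  have hc : ∀ t t', (Finset.univ.filter fun ω => f ω = t).card
      ≤ (Finset.univ.filter fun ω => f ω = t').card := by
    intro t t'
    obtain ⟨e, he, hm⟩ := h t t'
    exact Finset.card_le_card_of_injOn e (fun ω hω => by simpa using hm ω (by simpa using hω))
      he.injOn
  obtain ⟨ω₀⟩ := ‹Nonempty Ω›
  set c := (Finset.univ.filter fun ω => f ω = f ω₀).card with hcdef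
  have hcpos : 0 < c := Finset.card_pos.2 ⟨ω₀, by simp⟩
  have hall : ∀ t, (Finset.univ.filter fun ω => f ω = t).card = c :=
    fun t => le_antisymm (hc _ _) (hc _ _)
  have key : ∀ R : T → Prop, (Finset.univ.filter fun ω => R (f ω)).card
      = (Finset.univ.filter R).card * c := by
    intro R
    rw [Finset.card_eq_sum_card_fiberwise (f := f) (t := Finset.univ.filter R)
      (fun ω hω => by simpa using hω)]
    rw [Finset.sum_congr rfl (g := fun _ => c), Finset.sum_const, smul_eq_mul]
    intro t ht
    rw [← hall t, Finset.filter_filter]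
    congr 1
    ext ω
    simp only [Finset.mem_filter, Finset.mem_univ, true_and] at ht ⊢
    constructor
    · exact fun h => h.2
    · rintro rfl; exact ⟨ht, rfl⟩
  have htot := key fun _ => True
  simp only [Finset.filter_true, Finset.card_univ] at htot
  simp only [pr_def]
  rw [key Q, htot]
  push_cast
  rw [mul_div_mul_right]
  exact_mod_cast hcpos.ne'

lemma sum_pr_eq {V : Type*} [Fintype V] (E : V → Ω → Prop) [∀ ω, DecidablePred fun v => E v ω] :
    ∑ ω, ((Finset.univ.filter fun v => E v ω).card : ℝ)
      = Fintype.card Ω * ∑ v, pr (E v) := by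
  classical
  have h : (Fintype.card Ω : ℝ) ≠ 0 := by simp
  simp only [pr, Finset.card_filter, Finset.mul_sum]
  push_cast
  rw [Finset.sum_comm]
  refine Finset.sum_congr rfl fun v _ => ?_
  rw [mul_div_cancel₀ _ h]

open Classical in
/-- Markov's inequality for the number of events that occur. -/
lemma pr_card_filter_ge_le {V : Type*} [Fintype V] (E : V → Ω → Prop) {a q : ℝ} (ha : 0 < a)
    (hq : ∀ v, pr (E v) ≤ q) :
    pr (fun ω => a ≤ (Finset.univ.filter fun v => E v ω).card) ≤ Fintype.card V * q / a := by
  have h : (0 : ℝ) < Fintype.card Ω := by exact_mod_cast Fintype.card_pos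
  have hs := sum_pr_eq E
  have h1 : a * (Finset.univ.filter fun ω =>
      a ≤ (Finset.univ.filter fun v => E v ω).card).card
      ≤ ∑ ω, ((Finset.univ.filter fun v => E v ω).card : ℝ) := by
    calc _ = ∑ ω ∈ Finset.univ.filter (fun ω =>
          a ≤ (Finset.univ.filter fun v => E v ω).card), a := by simp [mul_comm]
      _ ≤ ∑ ω ∈ Finset.univ.filter (fun ω =>
          a ≤ (Finset.univ.filter fun v => E v ω).card),
            ((Finset.univ.filter fun v => E v ω).card : ℝ) :=
          Finset.sum_le_sum fun ω hω => by simpa using hω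
      _ ≤ _ := Finset.sum_le_sum_of_subset_of_nonneg (Finset.filter_subset _ _)
          fun _ _ _ => by positivity
  have h2 : ∑ v, pr (E v) ≤ Fintype.card V * q :=
    (Finset.sum_le_sum fun v _ => hq v).trans (by simp)
  simp only [pr_def] at *
  rw [div_le_div_iff₀ h ha, mul_comm]
  calc _ ≤ _ := h1
    _ = _ := hs
    _ ≤ _ := by rw [mul_comm]; gcongr

open Classical in
/-- Chebyshev's inequality for the number of events that occur. -/
lemma pr_card_filter_le_half_le {V : Type*} [Fintype V] (E : V → Ω → Prop) {p c : ℝ}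
    (hp : 0 < (Fintype.card V : ℝ) * p) (hc : 0 ≤ c)
    (h1 : ∀ v, pr (E v) = p) (h2 : ∀ u v, u ≠ v → pr (fun ω => E u ω ∧ E v ω) ≤ p ^ 2 + c) :
    pr (fun ω => ((Finset.univ.filter fun v => E v ω).card : ℝ) ≤ Fintype.card V * p / 2)
      ≤ 4 / (Fintype.card V * p) + 4 * c / p ^ 2 := by
  have hΩ : (0 : ℝ) < Fintype.card Ω := by exact_mod_cast Fintype.card_pos
  set N : ℝ := (Fintype.card V : ℝ) with hN
  set X : Ω → ℝ := fun ω => ((Finset.univ.filter fun v => E v ω).card : ℝ) with hX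
  have hN0 : 0 ≤ N := by positivity
  have hNpos : 0 < N := lt_of_le_of_ne hN0 (by rintro h; rw [← h] at hp; simp at hp)
  have hp0 : 0 < p := by
    by_contra! h
    nlinarith
  have s1 : ∑ ω, X ω = Fintype.card Ω * (N * p) := by
    rw [hX, sum_pr_eq E]; simp [h1, hN]
  have s2 : ∑ ω, X ω ^ 2 ≤ Fintype.card Ω * (N * p + N ^ 2 * (p ^ 2 + c)) := by
    -- The square counts ordered pairs of events that occur: diagonal pairs contribute `p`, all
    -- others at most `p ^ 2 + c`.
    have e1 : ∀ ω, X ω ^ 2 = ((Finset.univ.filter fun w : V × V => E w.1 ω ∧ E w.2 ω).card : ℝ) := by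
      intro ω
      rw [sq, ← Nat.cast_mul, ← Finset.card_product]
      congr 2
      ext w; simp
    simp_rw [e1]
    rw [sum_pr_eq fun (w : V × V) ω => E w.1 ω ∧ E w.2 ω]
    gcongr
    rw [Fintype.sum_prod_type]
    calc _ ≤ ∑ u : V, ∑ v : V, ((if u = v then p else 0) + (p ^ 2 + c)) := by
          gcongr with u _ v _
          split_ifs with huv
          · subst huv
            simp only [and_self, h1]
            nlinarith [sq_nonneg p]
          · simpa using h2 u v huv
      _ = _ := by
          simp [Finset.sum_add_distrib, hN]
          ring
  have s3 : ∑ ω, (X ω - N * p) ^ 2 ≤ Fintype.card Ω * (N * p + N ^ 2 * c) := by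
    have : ∑ ω, (X ω - N * p) ^ 2
        = ∑ ω, X ω ^ 2 - 2 * (N * p) * ∑ ω, X ω + Fintype.card Ω * (N * p) ^ 2 := by
      simp only [sub_sq, Finset.sum_add_distrib, Finset.sum_sub_distrib, Finset.mul_sum]
      simp [Finset.card_univ]
      refine Finset.sum_congr rfl fun _ _ => by ring
    rw [this, s1]
    nlinarith
  have s4 : ((Finset.univ.filter fun ω => X ω ≤ N * p / 2).card : ℝ) * (N * p / 2) ^ 2
      ≤ ∑ ω, (X ω - N * p) ^ 2 := by
    calc _ = ∑ ω ∈ Finset.univ.filter (fun ω => X ω ≤ N * p / 2), (N * p / 2) ^ 2 := by simp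
      _ ≤ ∑ ω ∈ Finset.univ.filter (fun ω => X ω ≤ N * p / 2), (X ω - N * p) ^ 2 := by
          refine Finset.sum_le_sum fun ω hω => ?_
          have : X ω ≤ N * p / 2 := by simpa using hω
          nlinarith
      _ ≤ _ := Finset.sum_le_sum_of_subset_of_nonneg (Finset.filter_subset _ _)
          fun _ _ _ => by positivity
  have s5 := s4.trans s3
  simp only [pr_def]
  have e : 4 / (N * p) + 4 * c / p ^ 2 = (N * p + N ^ 2 * c) / (N * p / 2) ^ 2 := by
    field_simp
    ring
  rw [e, div_le_div_iff₀ hΩ (by positivity), mul_comm (N * p + N ^ 2 * c)]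
  exact s5

end UniformProbability

/-! ### The random graph -/

instance {V : Type*} : Nonempty (SimpleGraph V) := ⟨⊥⟩

/-- At edge probability 1/2 an edge and a non-edge weigh the same, so all graphs have equal mass and
probabilities become counts. -/
lemma randomGraphProb_eq_pr (n : ℕ) (E : SimpleGraph (Fin n) → Prop) :
    randomGraphProb n E = pr E := by
  classical
  unfold randomGraphProb pr
  set μ := SimpleGraph.binomialRandom (Fin n) ⟨1 / 2, by norm_num, by norm_num⟩ with hμ
  set c : ℝ := (1 / 2) ^ (n.choose 2) with hc
  have hs : ∀ G, μ.real {G} = c := by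
    intro G
    have hle : G.edgeSet.ncard ≤ n.choose 2 := by
      have := G.card_edgeFinset_le_card_choose_two
      rw [Fintype.card_fin] at this
      rwa [Set.ncard_eq_toFinset_card']
    rw [MeasureTheory.measureReal_def, hμ, SimpleGraph.binomialRandom_singleton, hc]
    rw [← Nat.add_sub_cancel' hle, pow_add]
    have e1 : (unitInterval.toNNReal ⟨1 / 2, by norm_num, by norm_num⟩ : ℝ) = 1 / 2 := rfl
    have e2 : (unitInterval.toNNReal (unitInterval.symm ⟨1 / 2, by norm_num, by norm_num⟩) : ℝ)
        = 1 / 2 := by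
      change (1 - 1 / 2 : ℝ) = 1 / 2
      norm_num
    simp only [ENNReal.toReal_mul, ENNReal.toReal_pow, ENNReal.coe_toReal, Nat.card_fin, e1, e2]
  have hsum : ∀ s : Finset (SimpleGraph (Fin n)), μ.real (s : Set _) = s.card * c := by
    intro s
    have : MeasurableSingletonClass (SimpleGraph (Fin n)) := ⟨fun G => by
      convert SimpleGraph.measurable_edgeSet (measurableSet_singleton G.edgeSet)
      ext H; simp⟩
    rw [← MeasureTheory.sum_measureReal_singleton]
    simp [hs]
  have h1 := hsum Finset.univ
  rw [Finset.coe_univ, MeasureTheory.probReal_univ, Finset.card_univ] at h1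
  have h2 := hsum (Finset.univ.filter E)
  rw [Finset.coe_filter_univ] at h2
  rw [h2, eq_div_iff (by intro h; rw [h] at h1; simp at h1), mul_assoc, mul_comm c, ← h1, mul_one]

lemma aas_iff {E : ∀ n : ℕ, SimpleGraph (Fin n) → Prop} :
    AAS E ↔ Tendsto (fun n => pr fun G => ¬ E n G) atTop (𝓝 0) := by
  unfold AAS
  simp_rw [randomGraphProb_eq_pr, pr_not]
  constructor
  · intro h; simpa using h.const_sub 1
  · intro h; simpa using h.const_sub 1

lemma AAS.of_le {E : ∀ n : ℕ, SimpleGraph (Fin n) → Prop} {f : ℕ → ℝ}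
    (hf : Tendsto f atTop (𝓝 0)) (h : ∀ᶠ n in atTop, pr (fun G => ¬ E n G) ≤ f n) : AAS E :=
  aas_iff.2 (squeeze_zero' (Eventually.of_forall fun _ => pr_nonneg _) h hf)

lemma AAS.mono {E F : ∀ n : ℕ, SimpleGraph (Fin n) → Prop} (hE : AAS E)
    (h : ∀ᶠ n in atTop, ∀ G, E n G → F n G) : AAS F :=
  AAS.of_le (aas_iff.1 hE) (h.mono fun _ h => pr_mono fun G hF hE => hF (h G hE))

lemma AAS.and {E F : ∀ n : ℕ, SimpleGraph (Fin n) → Prop} (hE : AAS E) (hF : AAS F) :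
    AAS fun n G => E n G ∧ F n G := by
  refine AAS.of_le (by simpa using (aas_iff.1 hE).add (aas_iff.1 hF)) (.of_forall fun n => ?_)
  refine le_trans (pr_mono fun G h => ?_) (pr_or_le _ _)
  tauto

/-! ### Random subsets and the binomial distribution -/

/-- The probability that a uniformly random subset of an `m`-element set has `k` elements. -/
noncomputable def binPMF (m k : ℕ) : ℝ := m.choose k / 2 ^ m

/-- The probability that a uniformly random subset of an `m`-element set has at least `k`
elements. -/
noncomputable def binTail (m k : ℕ) : ℝ := ∑ j ∈ Finset.Icc k m, binPMF m j

lemma binPMF_nonneg (m k : ℕ) : 0 ≤ binPMF m k := by unfold binPMF; positivity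

lemma binTail_nonneg (m k : ℕ) : 0 ≤ binTail m k :=
  Finset.sum_nonneg fun _ _ => binPMF_nonneg _ _

lemma binTail_eq_add (m k : ℕ) : binTail m k = binPMF m k + binTail m (k + 1) := by
  unfold binTail
  rcases le_or_gt k m with h | h
  · rw [← Finset.add_sum_Ioc_eq_sum_Icc h]
    congr 2
    ext j
    simp only [Finset.mem_Ioc, Finset.mem_Icc]
    omega
  · rw [Finset.Icc_eq_empty (by omega), Finset.Icc_eq_empty (by omega)]
    simp [binPMF, Nat.choose_eq_zero_of_lt h]

section RandomSubset

variable {R : Type*} [Fintype R]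

lemma pr_card_eq (k : ℕ) : pr (fun A : Finset R => A.card = k) = binPMF (Fintype.card R) k := by
  classical
  rw [pr_def, binPMF, Fintype.card_finset]
  congr 2
  · rw [← Finset.card_univ, ← Finset.card_powersetCard]
    congr 1
    ext A; simp [Finset.mem_powersetCard]
  · norm_num

lemma pr_le_card (k : ℕ) : pr (fun A : Finset R => k ≤ A.card) = binTail (Fintype.card R) k := by
  classical
  have h := Finset.card_eq_sum_card_fiberwise (f := Finset.card)
    (s := Finset.univ.filter fun A : Finset R => k ≤ A.card)
    (t := Finset.Icc k (Fintype.card R)) (fun A hA => by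
      simpa using ⟨by simpa using hA, Finset.card_le_univ A⟩)
  rw [pr_def, h, binTail]
  push_cast
  rw [Finset.sum_div]
  refine Finset.sum_congr rfl fun j hj => ?_
  rw [← pr_card_eq (R := R), pr_def, Finset.filter_filter]
  congr 3
  ext A
  have := (Finset.mem_Icc.1 hj).1
  simp only [Finset.mem_filter, Finset.mem_univ, true_and]
  omega

lemma pr_card_add_le (k : ℕ) :
    pr (fun A : Finset R => A.card + k ≤ Fintype.card R) = binTail (Fintype.card R) k := by
  classical
  rw [← pr_le_card (R := R), pr_def, pr_def]
  congr 2
  refine Finset.card_bij (fun A _ => Aᶜ) (fun A hA => ?_) (fun A _ B _ h => compl_injective h)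
    fun A hA => ⟨Aᶜ, ?_, compl_compl A⟩
  · have : A.card + k ≤ Fintype.card R := by simpa using hA
    simp [Finset.card_compl]; omega
  · have h1 : k ≤ A.card := by simpa using hA
    have := Finset.card_le_univ A
    simp [Finset.card_compl]; omega

end RandomSubset

section ProductSpace

variable {α β : Type*} [Fintype α] [Fintype β]

lemma pr_bool_prod (Q : Bool × α → Prop) :
    pr Q = (pr (fun a => Q (true, a)) + pr (fun a => Q (false, a))) / 2 := by
  classical
  simp only [pr_def, Finset.card_filter, Fintype.sum_prod_type, Fintype.card_prod,
    Fintype.univ_bool, Fintype.card_bool]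
  rw [Finset.sum_insert (by simp), Finset.sum_singleton]
  push_cast
  rw [← add_div, div_div, mul_comm]

lemma pr_prod_le {Q : α × β → Prop} {P : α → Prop} {c : ℝ}
    (hP : ∀ a b, Q (a, b) → P a) (h : ∀ a, P a → pr (fun b => Q (a, b)) ≤ c) :
    pr Q ≤ pr P * c := by
  classical
  have e : pr Q = (∑ a, pr fun b => Q (a, b)) / Fintype.card α := by
    simp only [pr_def, Finset.card_filter, Fintype.sum_prod_type, Fintype.card_prod]
    push_cast
    rw [← Finset.sum_div, div_div, mul_comm]
  have e2 : ∑ a, (pr fun b => Q (a, b)) ≤ ∑ a, if P a then c else 0 := by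
    refine Finset.sum_le_sum fun a _ => ?_
    split_ifs with ha
    · exact h a ha
    · have : ∀ b, ¬ Q (a, b) := fun b hb => ha (hP a b hb)
      simp [pr, this]
  rw [e, pr_def P, div_mul_eq_mul_div]
  gcongr
  simpa [Finset.sum_ite] using e2

lemma pr_and_prod (P : α → Prop) (Q : β → Prop) :
    pr (fun x : α × β => P x.1 ∧ Q x.2) = pr P * pr Q := by
  classical
  simp only [pr_def, Fintype.card_prod]
  rw [div_mul_div_comm]
  congr 1
  · rw [← Nat.cast_mul, ← Finset.card_product]
    congr 2
    ext x; simp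
  · push_cast; rfl

end ProductSpace

/-- Each element independently avoids lying in both sets, which leaves three of its four placements.
-/
lemma pr_disjoint {R : Type*} [Fintype R] :
    pr (fun x : Finset R × Finset R => Disjoint x.1 x.2) = (3 / 4) ^ Fintype.card R := by
  classical
  have h : (Finset.univ.filter fun x : Finset R × Finset R => Disjoint x.1 x.2).card
      = 3 ^ Fintype.card R := by
    rw [Finset.card_filter, Fintype.sum_prod_type]
    have : ∀ A : Finset R, (∑ B : Finset R, if Disjoint A B then 1 else 0)
        = 1 ^ A.card * 2 ^ (Fintype.card R - A.card) := by
      intro A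
      rw [← Finset.card_filter, one_pow, one_mul, ← Finset.card_compl, ← Finset.card_powerset]
      congr 1
      ext B
      simp only [Finset.mem_filter, Finset.mem_univ, true_and, Finset.mem_powerset]
      rw [disjoint_comm, Finset.subset_compl_iff_disjoint_right]
    simp only [this]
    rw [Fintype.sum_pow_mul_eq_add_pow]
  rw [pr_def, h]
  simp only [Fintype.card_prod, Fintype.card_finset]
  push_cast
  rw [← mul_pow, ← div_pow]
  norm_num

/-! ### The neighborhoods of two vertices of a random graph -/

section PairView

variable {V : Type*} [Fintype V] [DecidableEq V] {u v : V}

/-- The vertices different from `u` and `v`. -/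
abbrev Others (u v : V) := {w : V // w ≠ u ∧ w ≠ v}

open Classical in
/-- Whether `u` and `v` are adjacent, and their other neighbors. -/
noncomputable def pairView (u v : V) (G : SimpleGraph V) :
    Bool × Finset (Others u v) × Finset (Others u v) :=
  (decide (G.Adj u v), Finset.univ.filter fun w => G.Adj u w,
    Finset.univ.filter fun w => G.Adj v w)

open Classical in
lemma pr_pairView (huv : u ≠ v)
    (Q : Bool × Finset (Others u v) × Finset (Others u v) → Prop) :
    pr (fun G => Q (pairView u v G)) = pr Q := by
  refine pr_comp_of_fiber_injections _ ?_ Q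
  intro t t'
  -- `H` consists of the pairs at `u` or `v` on which `t` and `t'` differ; toggling them carries the
  -- fiber of `t` into that of `t'`.
  let H : SimpleGraph V := SimpleGraph.fromRel fun a b =>
    (a = u ∧ b = v ∧ t.1 ≠ t'.1) ∨
    (a = u ∧ ∃ h, ¬ ((⟨b, h⟩ : Others u v) ∈ t.2.1 ↔ ⟨b, h⟩ ∈ t'.2.1)) ∨
    (a = v ∧ ∃ h, ¬ ((⟨b, h⟩ : Others u v) ∈ t.2.2 ↔ ⟨b, h⟩ ∈ t'.2.2))
  refine ⟨fun G => symmDiff G H, symmDiff_left_injective H, ?_⟩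
  rintro G rfl
  have hadj : ∀ a b, (symmDiff G H).Adj a b ↔ ¬ (G.Adj a b ↔ H.Adj a b) := by
    intro a b
    simp only [symmDiff, SimpleGraph.sup_adj, SimpleGraph.sdiff_adj]
    tauto
  have hvu := huv.symm
  refine Prod.ext ?_ (Prod.ext ?_ ?_)
  · have : H.Adj u v ↔ ¬ ((pairView u v G).1 = t'.1) := by
      simp [H, SimpleGraph.fromRel_adj, huv, hvu]
    simp only [pairView, hadj, this]
    cases t'.1 <;> simp
  · ext ⟨w, hw⟩
    have : H.Adj u w ↔ ¬ (((⟨w, hw⟩ : Others u v) ∈ (pairView u v G).2.1)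
        ↔ ⟨w, hw⟩ ∈ t'.2.1) := by
      simp [H, SimpleGraph.fromRel_adj, huv, hw.1, hw.2, hw.1.symm]
    simp only [pairView, Finset.mem_filter, Finset.mem_univ, true_and, hadj, this]
    tauto
  · ext ⟨w, hw⟩
    have : H.Adj v w ↔ ¬ (((⟨w, hw⟩ : Others u v) ∈ (pairView u v G).2.2)
        ↔ ⟨w, hw⟩ ∈ t'.2.2) := by
      simp [H, SimpleGraph.fromRel_adj, hvu, hw.1, hw.2, hw.2.symm]
    simp only [pairView, Finset.mem_filter, Finset.mem_univ, true_and, hadj, this]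
    tauto

lemma card_others (huv : u ≠ v) : Fintype.card (Others u v) = Fintype.card V - 2 := by
  rw [Fintype.card_subtype, show (Finset.univ.filter fun w => w ≠ u ∧ w ≠ v) = {u, v}ᶜ by
    ext; simp, Finset.card_compl, Finset.card_pair huv]

open Classical in
lemma degree_eq_left (G : SimpleGraph V) (huv : u ≠ v) :
    G.degree u = (pairView u v G).2.1.card + (pairView u v G).1.toNat := by
  have : G.neighborFinset u = (pairView u v G).2.1.map (Function.Embedding.subtype _) ∪
      if G.Adj u v then {v} else ∅ := by
    ext w
    by_cases h : w = v
    · subst h; split_ifs <;> simp [pairView, *]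
    · have := fun h : G.Adj u w => h.ne'
      split_ifs <;> simp [pairView, h] <;> tauto
  rw [← SimpleGraph.card_neighborFinset_eq_degree, this, Finset.card_union_of_disjoint,
    Finset.card_map]
  · simp only [pairView]; split_ifs <;> simp [*]
  · split_ifs <;> simp

open Classical in
lemma degree_eq_right (G : SimpleGraph V) (huv : u ≠ v) :
    G.degree v = (pairView u v G).2.2.card + (pairView u v G).1.toNat := by
  have : G.neighborFinset v = (pairView u v G).2.2.map (Function.Embedding.subtype _) ∪
      if G.Adj u v then {u} else ∅ := by
    ext w
    by_cases h : w = u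
    · subst h; split_ifs with h' <;> simpa [pairView, SimpleGraph.adj_comm] using h'
    · have := fun h : G.Adj v w => h.ne'
      split_ifs <;> simp [pairView, h] <;> tauto
  rw [← SimpleGraph.card_neighborFinset_eq_degree, this, Finset.card_union_of_disjoint,
    Finset.card_map]
  · simp only [pairView]; split_ifs <;> simp [*]
  · split_ifs <;> simp

open Classical in
lemma pr_le_degree (huv : u ≠ v) (k : ℕ) :
    pr (fun G : SimpleGraph V => k + 1 ≤ G.degree u)
      = (binTail (Fintype.card V - 2) k + binTail (Fintype.card V - 2) (k + 1)) / 2 := by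
  simp_rw [degree_eq_left _ huv]
  rw [pr_pairView huv fun t => k + 1 ≤ t.2.1.card + t.1.toNat, pr_bool_prod, ← card_others huv]
  have h : ∀ P : Finset (Others u v) → Prop,
      pr (fun x : Finset (Others u v) × Finset (Others u v) => P x.1) = pr P := by
    intro P
    have := pr_and_prod P fun _ : Finset (Others u v) => True
    simp only [and_true] at this
    rw [this]
    simp [pr]
  simp only [Bool.toNat_true, Bool.toNat_false, add_le_add_iff_right, add_zero]
  rw [h fun A => k ≤ A.card, h fun A => k + 1 ≤ A.card, pr_le_card, pr_le_card]

open Classical in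
-- Given whether `u` and `v` are adjacent, the two degrees are independent. This shared bit is their
-- only correlation and yields a covariance of just a quarter of the squared binomial mass at `k`.
lemma pr_le_degree_and_le_degree (huv : u ≠ v) (k : ℕ) :
    pr (fun G : SimpleGraph V => k + 1 ≤ G.degree u ∧ k + 1 ≤ G.degree v)
      = (binTail (Fintype.card V - 2) k ^ 2 + binTail (Fintype.card V - 2) (k + 1) ^ 2) / 2 := by
  simp_rw [degree_eq_left _ huv, degree_eq_right _ huv]
  rw [pr_pairView huv fun t => k + 1 ≤ t.2.1.card + t.1.toNat ∧ k + 1 ≤ t.2.2.card + t.1.toNat,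
    pr_bool_prod, ← card_others huv]
  simp only [Bool.toNat_true, Bool.toNat_false, add_le_add_iff_right, add_zero]
  rw [pr_and_prod (fun A : Finset (Others u v) => k ≤ A.card)
      fun A : Finset (Others u v) => k ≤ A.card,
    pr_and_prod (fun A : Finset (Others u v) => k + 1 ≤ A.card)
      fun A : Finset (Others u v) => k + 1 ≤ A.card, pr_le_card, pr_le_card, sq, sq]

open Classical in
lemma pr_degree_add_le_le (huv : u ≠ v) (k : ℕ) :
    pr (fun G : SimpleGraph V => G.degree u + k ≤ Fintype.card V - 2)
      ≤ binTail (Fintype.card V - 2) k := by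
  calc _ ≤ pr (fun G : SimpleGraph V => (fun t : Bool × _ × _ => t.2.1.card + k
        ≤ Fintype.card (Others u v)) (pairView u v G)) := by
        refine pr_mono fun G h => ?_
        rw [degree_eq_left _ huv] at h
        rw [card_others huv]
        dsimp only
        omega
    _ = _ := by
      rw [pr_pairView huv (fun t => t.2.1.card + k ≤ Fintype.card (Others u v)),
        ← card_others huv, ← pr_card_add_le (R := Others u v),
        pr_bool_prod (fun t : Bool × Finset (Others u v) × Finset (Others u v) => t.2.1.card + k ≤ Fintype.card (Others u v))]
      have := pr_and_prod (fun A : Finset (Others u v) => A.card + k ≤ Fintype.card (Others u v))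
        fun _ : Finset (Others u v) => True
      simp only [and_true] at this
      rw [this]
      simp [pr]

lemma pr_no_common_neighbor (huv : u ≠ v) :
    pr (fun G : SimpleGraph V => ¬ ∃ w, G.Adj u w ∧ G.Adj v w)
      ≤ (3 / 4) ^ (Fintype.card V - 2) := by
  calc _ ≤ pr (fun G : SimpleGraph V => (fun t : Bool × _ × _ => Disjoint t.2.1 t.2.2)
        (pairView u v G)) := by
        refine pr_mono fun G h => ?_
        dsimp only
        rw [Finset.disjoint_left]
        intro w hw hw'
        simp only [pairView, Finset.mem_filter, Finset.mem_univ, true_and] at hw hw'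
        exact h ⟨w, hw, hw'⟩
    _ = _ := by
      rw [pr_pairView huv (fun t => Disjoint t.2.1 t.2.2),
        pr_bool_prod (fun t : Bool × Finset (Others u v) × Finset (Others u v) => Disjoint t.2.1 t.2.2),
        pr_disjoint, card_others huv]
      exact add_self_div_two _

open Classical in
/-- Two vertices of a random graph rarely have almost equal and large degrees. -/
lemma pr_degree_close_le (huv : u ≠ v) {S : ℕ}
    (hS : ∀ k, S ≤ k → binPMF (Fintype.card V - 2) k ≤ binPMF (Fintype.card V - 2) S) :
    pr (fun G : SimpleGraph V => S + 6 ≤ G.degree u ∧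
        G.degree u ≤ G.degree v + 5 ∧ G.degree v ≤ G.degree u + 5)
      ≤ binTail (Fintype.card V - 2) (S + 5) * (11 * binPMF (Fintype.card V - 2) S) := by
  let Q : Finset (Others u v) × Finset (Others u v) → Prop := fun x =>
    S + 5 ≤ x.1.card ∧ x.1.card ≤ x.2.card + 5 ∧ x.2.card ≤ x.1.card + 5
  calc _ ≤ pr (fun G : SimpleGraph V => (fun t : Bool × _ × _ => Q t.2) (pairView u v G)) := by
        -- The edge between `u` and `v` counts in both degrees, so removing it preserves their
        -- difference and lowers the threshold by at most one.
        refine pr_mono fun G h => ?_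
        rw [degree_eq_left _ huv, degree_eq_right _ huv] at h
        have := Bool.toNat_le (pairView u v G).1
        dsimp only [Q]
        omega
    _ = pr Q := by
        rw [pr_pairView huv (fun t => Q t.2),
          pr_bool_prod (fun t : Bool × Finset (Others u v) × Finset (Others u v) => Q t.2)]
        exact add_self_div_two _
    _ ≤ _ := by
        rw [← card_others huv, ← pr_le_card (R := Others u v)]
        have hQ : ∀ a b, Q (a, b) → S + 5 ≤ a.card := fun a b h => h.1
        refine pr_prod_le hQ fun A hA => ?_
        -- Once the first set is fixed, the second size has 11 possible values, all at least `S`.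
        calc _ ≤ pr (fun B : Finset (Others u v) => ∃ i : Fin 11, B.card = A.card - 5 + i) := by
              refine pr_mono fun B hB => ⟨⟨B.card - (A.card - 5), ?_⟩, ?_⟩
              · dsimp only [Q] at hB; omega
              · dsimp only [Q] at hB ⊢; omega
          _ ≤ Fintype.card (Fin 11) * binPMF (Fintype.card (Others u v)) S := by
              refine pr_exists_le_card_mul _ fun i => ?_
              rw [pr_card_eq, card_others huv]
              exact hS _ (by omega)
          _ = _ := by simp

end PairView

/-! ### Estimates for the binomial distribution -/

lemma binPMF_succ_mul (m k : ℕ) :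
    binPMF m (k + 1) * (k + 1) = binPMF m k * ((m - k : ℕ) : ℝ) := by
  have := Nat.choose_succ_right_eq m k
  unfold binPMF
  rw [div_mul_eq_mul_div, div_mul_eq_mul_div]
  congr 1
  exact_mod_cast this

lemma binPMF_le_of_le {m k l : ℕ} (hk : m / 2 ≤ k) (hkl : k ≤ l) : binPMF m l ≤ binPMF m k := by
  induction l, hkl using Nat.le_induction with
  | base => exact le_rfl
  | succ l hl ih =>
    refine le_trans ?_ ih
    have h1 := binPMF_succ_mul m l
    have h2 : ((m - l : ℕ) : ℝ) ≤ l + 1 := by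
      have : m - l ≤ l + 1 := by omega
      exact_mod_cast this
    have h3 := binPMF_nonneg m l
    have h4 : (0 : ℝ) < l + 1 := by positivity
    refine le_of_mul_le_mul_right ?_ h4
    rw [h1]
    gcongr

lemma binPMF_le_one (m k : ℕ) : binPMF m k ≤ 1 := by
  unfold binPMF
  rw [div_le_one (by positivity)]
  exact_mod_cast Nat.choose_le_two_pow m k

lemma one_div_le_binPMF_half (m : ℕ) : 1 / ((m : ℝ) + 1) ≤ binPMF m (m / 2) := by
  unfold binPMF
  rw [div_le_div_iff₀ (by positivity) (by positivity), one_mul]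
  have : 2 ^ m ≤ m.choose (m / 2) * (m + 1) := by
    rw [← Nat.sum_range_choose]
    refine (Finset.sum_le_sum fun i _ => Nat.choose_le_middle i m).trans ?_
    simp [mul_comm]
  exact_mod_cast this

/-- With q = m / 2, the ratio of consecutive masses is at most (q + 1 - t) / (q + 1 + t), hence at
most 1 - t / (q + 1). -/
lemma binPMF_step_le (m t : ℕ) :
    binPMF m (m / 2 + t + 1) ≤ Real.exp (-(t / ((m / 2 : ℕ) + 1))) * binPMF m (m / 2 + t) := by
  rcases lt_or_ge m (m / 2 + t + 1) with h | h
  · have : binPMF m (m / 2 + t + 1) = 0 := by simp [binPMF, Nat.choose_eq_zero_of_lt h]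
    rw [this]
    exact mul_nonneg (Real.exp_pos _).le (binPMF_nonneg _ _)
  have h1 := binPMF_succ_mul m (m / 2 + t)
  set q := m / 2 with hq
  have h2 : ((m - (q + t) : ℕ) : ℝ) ≤ q + 1 - t := by
    have : m - (q + t) + t ≤ q + 1 := by omega
    have : ((m - (q + t) : ℕ) : ℝ) + t ≤ q + 1 := by exact_mod_cast this
    linarith
  have ht : (t : ℝ) ≤ q + 1 := by
    have : t ≤ q + 1 := by omega
    exact_mod_cast this
  have hb := binPMF_nonneg m (q + t)
  have hq0 : (0 : ℝ) < q + 1 := by positivity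
  have h3 : (q + 1 - t : ℝ) ≤ (1 - t / (q + 1)) * (q + 1 + t) := by
    have e : (1 - t / (q + 1) : ℝ) * (q + 1 + t) = q + 1 - t * (t / (q + 1)) := by
      field_simp
      ring
    rw [e]
    have : (t : ℝ) / (q + 1) ≤ 1 := (div_le_one hq0).2 ht
    nlinarith [(Nat.cast_nonneg t : (0 : ℝ) ≤ t)]
  have h4 : (1 - t / (q + 1) : ℝ) ≤ Real.exp (-(t / (q + 1))) := by
    have := Real.add_one_le_exp (-(t / (q + 1) : ℝ))
    linarith
  have h5 : (0 : ℝ) < q + 1 + t := by positivity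
  refine le_of_mul_le_mul_right ?_ h5
  push_cast at h1
  calc _ = binPMF m (q + t) * ((m - (q + t) : ℕ) : ℝ) := by rw [← h1]; ring
    _ ≤ binPMF m (q + t) * ((1 - t / (q + 1)) * (q + 1 + t)) := by gcongr; linarith
    _ ≤ binPMF m (q + t) * (Real.exp (-(t / (q + 1))) * (q + 1 + t)) := by gcongr
    _ = _ := by ring

/-- A crude Chernoff bound: each of the `t` steps between offsets `t` and `2 * t` gains at least the
factor available at offset `t`. -/
lemma binPMF_half_add_two_mul_le (m t : ℕ) :
    binPMF m (m / 2 + 2 * t) ≤ Real.exp (-(t ^ 2 / ((m / 2 : ℕ) + 1))) := by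
  have key : ∀ i : ℕ, binPMF m (m / 2 + (t + i))
      ≤ Real.exp (-(t / ((m / 2 : ℕ) + 1))) ^ i := by
    intro i
    induction i with
    | zero => simpa using binPMF_le_one _ _
    | succ i ih =>
      refine (binPMF_step_le m (t + i)).trans ?_
      rw [pow_succ, mul_comm]
      have hb := binPMF_nonneg m (m / 2 + (t + i))
      gcongr
      simp
  refine le_trans (by simpa [two_mul] using key t) ?_
  rw [← Real.exp_nat_mul]
  refine le_of_eq ?_
  congr 1
  ring

lemma le_binPMF_step (m t : ℕ) :
    (1 - (2 * t + 1) / ((m / 2 : ℕ) + 1)) * binPMF m (m / 2 + t) ≤ binPMF m (m / 2 + t + 1) := by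
  set q := m / 2 with hq
  have hb := binPMF_nonneg m (q + t)
  have hq0 : (0 : ℝ) < q + 1 := by positivity
  rcases le_or_gt q t with h | h
  · have : (1 - (2 * t + 1) / (q + 1) : ℝ) ≤ 0 := by
      rw [sub_nonpos, one_le_div hq0]
      have : (q : ℝ) ≤ t := by exact_mod_cast h
      linarith [(Nat.cast_nonneg t : (0 : ℝ) ≤ t)]
    exact (mul_nonpos_of_nonpos_of_nonneg this hb).trans (binPMF_nonneg _ _)
  have h1 := binPMF_succ_mul m (q + t)
  have h2 : (q - t : ℝ) ≤ ((m - (q + t) : ℕ) : ℝ) := by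
    have : q ≤ m - (q + t) + t := by omega
    have : (q : ℝ) ≤ ((m - (q + t) : ℕ) : ℝ) + t := by exact_mod_cast this
    linarith
  have h5 : (0 : ℝ) < q + 1 + t := by positivity
  have h3 : (1 - (2 * t + 1) / (q + 1)) * (q + 1 + t) ≤ (q - t : ℝ) := by
    have e : (1 - (2 * t + 1) / (q + 1) : ℝ) * (q + 1 + t)
        = (q - t) - (2 * t + 1) * t / (q + 1) := by
      field_simp
      ring
    rw [e]
    have : (0 : ℝ) ≤ (2 * t + 1) * t / (q + 1) := by positivity
    linarith
  refine le_of_mul_le_mul_right ?_ h5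
  push_cast at h1
  calc _ = binPMF m (q + t) * ((1 - (2 * t + 1) / (q + 1)) * (q + 1 + t)) := by ring
    _ ≤ binPMF m (q + t) * ((m - (q + t) : ℕ) : ℝ) := by gcongr; linarith
    _ = _ := by rw [← h1]; ring

/-- As long as the offset stays within `D`, a step loses at most the fraction `δ`; Bernoulli's
inequality accumulates the losses. -/
lemma le_binPMF_half_add (m t D : ℕ) {δ : ℝ} (hδ : (2 * D + 1) / ((m / 2 : ℕ) + 1) ≤ δ)
    (hδ1 : δ ≤ 1) {i : ℕ} (hi : t + i ≤ D) :
    (1 - i * δ) * binPMF m (m / 2 + t) ≤ binPMF m (m / 2 + t + i) := by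
  induction i with
  | zero => simp
  | succ i ih =>
    have h1 := ih (by omega)
    have h2 := le_binPMF_step m (t + i)
    have hb := binPMF_nonneg m (m / 2 + t + i)
    have hb0 := binPMF_nonneg m (m / 2 + t)
    have h3 : (2 * ((t + i : ℕ) : ℝ) + 1) / ((m / 2 : ℕ) + 1) ≤ δ := by
      refine le_trans ?_ hδ
      have : ((t + i : ℕ) : ℝ) ≤ D := by exact_mod_cast (by omega)
      gcongr
    have hδ0 : 0 ≤ δ := le_trans (by positivity) h3
    rw [← add_assoc] at h2
    rw [← add_assoc]
    calc _ ≤ (1 - δ) * ((1 - i * δ) * binPMF m (m / 2 + t)) := by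
          push_cast
          have : 0 ≤ i * δ ^ 2 * binPMF m (m / 2 + t) := by positivity
          nlinarith
      _ ≤ (1 - δ) * binPMF m (m / 2 + t + i) := by
          gcongr
      _ ≤ (1 - (2 * ((t + i : ℕ) : ℝ) + 1) / ((m / 2 : ℕ) + 1)) * binPMF m (m / 2 + t + i) := by
          gcongr
      _ ≤ _ := h2

lemma sum_range_binPMF_le_binTail (m k r : ℕ) :
    ∑ i ∈ Finset.range r, binPMF m (k + i) ≤ binTail m k := by
  induction r generalizing k with
  | zero => simpa using binTail_nonneg m k
  | succ r ih =>
    rw [Finset.sum_range_succ', binTail_eq_add, add_comm]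
    gcongr
    · simp
    · refine le_trans (le_of_eq ?_) (ih (k + 1))
      refine Finset.sum_congr rfl fun i _ => ?_
      congr 1
      ring

lemma binTail_le {m k : ℕ} (hk : m / 2 ≤ k) : binTail m k ≤ (m + 1) * binPMF m k := by
  unfold binTail
  refine (Finset.sum_le_card_nsmul _ _ (binPMF m k) fun j hj =>
    binPMF_le_of_le hk (Finset.mem_Icc.1 hj).1).trans ?_
  rw [nsmul_eq_mul]
  have := binPMF_nonneg m k
  gcongr
  have : (Finset.Icc k m).card ≤ m + 1 := by simp
  exact_mod_cast this

lemma binPMF_tail_le_exp {m u : ℕ} {x : ℝ} (hx : 0 < x) (hn : (m : ℝ) + 2 = x ^ 20)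
    (hu : x ^ 11 ≤ u) : binPMF m (m / 2 + 2 * u) ≤ Real.exp (-x ^ 2) := by
  refine (binPMF_half_add_two_mul_le m u).trans (Real.exp_le_exp.2 ?_)
  rw [neg_le_neg_iff, le_div_iff₀ (by positivity)]
  have h1 : ((m / 2 : ℕ) : ℝ) + 1 ≤ x ^ 20 := by
    have : ((m / 2 : ℕ) : ℝ) ≤ m := by exact_mod_cast Nat.div_le_self _ _
    linarith
  calc x ^ 2 * (((m / 2 : ℕ) : ℝ) + 1) ≤ x ^ 2 * x ^ 20 := by gcongr
    _ = (x ^ 11) ^ 2 := by ring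
    _ ≤ _ := by gcongr

/-- There is a threshold at which the binomial probabilities are `o(1 / n)` while the tail beyond
it is much larger than `1 / n`. -/
lemma exists_binomial_threshold {m : ℕ} {x : ℝ} (hx : 144 ≤ x) (hn : (m : ℝ) + 2 = x ^ 20)
    (hexp : x ^ 21 ≤ Real.exp (x ^ 2)) :
    ∃ S, m / 2 ≤ S ∧ ((m : ℝ) + 2) * binPMF m S ≤ 1 / x ∧
      8 * x ≤ ((m : ℝ) + 2) * binTail m (S + 5) := by
  classical
  have hx0 : 0 < x := by linarith
  have hx1 : 1 ≤ x := by linarith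
  -- The standard deviation has order x ^ 10, so at offset 2 * x ^ 11 the mass has already dropped
  -- below exp (-x ^ 2).
  set u := ⌈x ^ 11⌉₊ with hu
  have hu1 : x ^ 11 ≤ u := Nat.le_ceil _
  have hu2 : (u : ℝ) < x ^ 11 + 1 := Nat.ceil_lt_add_one (by positivity)
  set s := ⌈x ^ 8⌉₊ with hs
  have hs1 : x ^ 8 ≤ s := Nat.le_ceil _
  have hs2 : (s : ℝ) < x ^ 8 + 1 := Nat.ceil_lt_add_one (by positivity)
  -- The threshold is the first offset whose mass is at most 1 / (n * x). The mass just before it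
  -- exceeds this value, and decays by at most half over the next `s`, about x ^ 8, steps; these
  -- steps make the tail large.
  have hex : ∃ j, binPMF m (m / 2 + j) ≤ 1 / x ^ 21 := by
    refine ⟨2 * u, (binPMF_tail_le_exp hx0 hn hu1).trans ?_⟩
    rw [Real.exp_neg, ← one_div]
    gcongr
  have hj := Nat.find_spec hex
  have hjle : Nat.find hex ≤ 2 * u := by
    refine Nat.find_min' hex ((binPMF_tail_le_exp hx0 hn hu1).trans ?_)
    rw [Real.exp_neg, ← one_div]
    gcongr
  have hj0 : Nat.find hex ≠ 0 := by
    intro h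
    rw [h, add_zero] at hj
    have h1 := one_div_le_binPMF_half m
    have h2 : 1 / x ^ 21 < 1 / ((m : ℝ) + 1) := by
      apply one_div_lt_one_div_of_lt (by positivity)
      have : x ^ 20 ≤ x ^ 21 := pow_le_pow_right₀ hx1 (by norm_num)
      linarith
    linarith
  obtain ⟨t, ht⟩ := Nat.exists_eq_succ_of_ne_zero hj0
  have hb : 1 / x ^ 21 < binPMF m (m / 2 + t) := by
    have := Nat.find_min hex (m := t) (by omega)
    exact not_le.1 this
  refine ⟨m / 2 + Nat.find hex, by omega, ?_, ?_⟩
  · rw [hn]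
    calc _ ≤ x ^ 20 * (1 / x ^ 21) := by gcongr
      _ = _ := by field_simp
  · have e : m / 2 + Nat.find hex + 5 = m / 2 + t + 6 := by omega
    rw [e, hn]
    have hm : x ^ 20 / 4 ≤ ((m / 2 : ℕ) : ℝ) + 1 := by
      have : (m : ℝ) ≤ 2 * ((m / 2 : ℕ) : ℝ) + 1 := by
        have : m ≤ 2 * (m / 2) + 1 := by omega
        exact_mod_cast this
      have := pow_le_pow_right₀ hx1 (show 1 ≤ 20 by norm_num)
      linarith
    have p11 : x ≤ x ^ 11 := by simpa using pow_le_pow_right₀ hx1 (show 1 ≤ 11 by norm_num)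
    have p8 : x ≤ x ^ 8 := by simpa using pow_le_pow_right₀ hx1 (show 1 ≤ 8 by norm_num)
    have p811 : x ^ 8 ≤ x ^ 11 := pow_le_pow_right₀ hx1 (by norm_num)
    have hδ : (2 * ((2 * u + s : ℕ) : ℝ) + 1) / ((m / 2 : ℕ) + 1) ≤ 36 / x ^ 9 := by
      calc _ ≤ 9 * x ^ 11 / (x ^ 20 / 4) := by
            gcongr
            push_cast
            linarith
        _ = _ := by field_simp; norm_num
    have hs6 : 6 ≤ s := by
      have : (6 : ℝ) ≤ s := by linarith
      exact_mod_cast this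
    have hδ1 : 36 / x ^ 9 ≤ 1 := by
      rw [div_le_one (by positivity)]
      have : x ≤ x ^ 9 := by simpa using pow_le_pow_right₀ hx1 (show 1 ≤ 9 by norm_num)
      linarith
    -- The total loss over `s` steps is at most 72 / x, which is where the assumption 144 ≤ x comes
    -- from.
    have hsδ : (s : ℝ) * (36 / x ^ 9) ≤ 1 / 2 := by
      calc _ ≤ (2 * x ^ 8) * (36 / x ^ 9) := by gcongr; linarith
        _ = 72 / x := by field_simp; norm_num
        _ ≤ 1 / 2 := by rw [div_le_div_iff₀ hx0 (by norm_num)]; linarith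
    have hterm : ∀ i ∈ Finset.range (s - 5), 1 / (2 * x ^ 21) ≤ binPMF m (m / 2 + t + 6 + i) := by
      intro i hi
      have hi' : 6 + i ≤ s := by have := Finset.mem_range.1 hi; omega
      have h1 := le_binPMF_half_add m t (2 * u + s) hδ hδ1 (i := 6 + i) (by omega)
      rw [← add_assoc] at h1
      have h2 : (1 / 2 : ℝ) ≤ 1 - ((6 + i : ℕ) : ℝ) * (36 / x ^ 9) := by
        have : ((6 + i : ℕ) : ℝ) * (36 / x ^ 9) ≤ s * (36 / x ^ 9) := by gcongr
        linarith
      refine le_trans ?_ h1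
      calc 1 / (2 * x ^ 21) = 1 / 2 * (1 / x ^ 21) := by field_simp
        _ ≤ _ := by gcongr
    have h1 := (Finset.card_nsmul_le_sum _ _ _ hterm).trans (sum_range_binPMF_le_binTail _ _ _)
    rw [Finset.card_range, nsmul_eq_mul, Nat.cast_sub (by omega)] at h1
    have h2 : x ^ 20 * ((x ^ 8 - 5) * (1 / (2 * x ^ 21))) ≤ x ^ 20 * binTail m (m / 2 + t + 6) := by
      gcongr
      refine le_trans ?_ h1
      gcongr
      push_cast
      linarith
    refine le_trans ?_ h2
    have e2 : x ^ 20 * ((x ^ 8 - 5) * (1 / (2 * x ^ 21))) = (x ^ 8 - 5) / (2 * x) := by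
      field_simp
    rw [e2, le_div_iff₀ (by positivity)]
    have p3 : 144 * x ^ 2 ≤ x ^ 8 := by
      calc 144 * x ^ 2 ≤ x * x ^ 2 := by gcongr
        _ = x ^ 3 := by ring
        _ ≤ x ^ 8 := pow_le_pow_right₀ hx1 (by norm_num)
    nlinarith

/-! ### The scale of the estimates -/

/-- The twentieth root of `n`. -/
noncomputable def scale (n : ℕ) : ℝ := (n : ℝ) ^ (1 / 20 : ℝ)

lemma scale_pow (n : ℕ) : scale n ^ 20 = n := by
  unfold scale
  rw [← Real.rpow_natCast, ← Real.rpow_mul (Nat.cast_nonneg n)]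
  norm_num

lemma tendsto_scale : Tendsto scale atTop atTop :=
  (tendsto_rpow_atTop (by norm_num)).comp tendsto_natCast_atTop_atTop

lemma tendsto_pow_mul_exp_neg_scale {b : ℝ} (hb : 0 < b) (k : ℕ) :
    Tendsto (fun n => scale n ^ k * Real.exp (-b * scale n)) atTop (𝓝 0) := by
  have := (tendsto_rpow_mul_exp_neg_mul_atTop_nhds_zero k b hb).comp tendsto_scale
  simpa [Function.comp_def] using this

lemma eventually_pow_le_exp_scale (k : ℕ) :
    ∀ᶠ n in atTop, scale n ^ k ≤ Real.exp (scale n) := by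
  have := tendsto_pow_mul_exp_neg_scale one_pos k
  filter_upwards [this.eventually_le_const one_pos] with n hn
  rw [neg_mul, one_mul, Real.exp_neg, ← div_eq_mul_inv, div_le_one (Real.exp_pos _)] at hn
  exact hn

/-! ### Properties of almost all graphs -/

/-- Any two vertices, distinct or not, have a common neighbor. -/
def HasCommonNeighbors {V : Type*} (G : SimpleGraph V) : Prop :=
  ∀ u v, ∃ w, G.Adj u w ∧ G.Adj v w

lemma aas_hasCommonNeighbors : AAS fun _ G => HasCommonNeighbors G := by
  have hlim : Tendsto (fun n : ℕ => (16 / 9 : ℝ) * ((n : ℝ) ^ 2 * (3 / 4) ^ n)) atTop (𝓝 0) := by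
    have := tendsto_pow_const_mul_const_pow_of_lt_one 2 (show (0 : ℝ) ≤ 3 / 4 by norm_num)
      (by norm_num)
    simpa using this.const_mul (16 / 9 : ℝ)
  refine AAS.of_le hlim ?_
  filter_upwards [eventually_ge_atTop 2] with n hn
  calc _ ≤ pr (fun G : SimpleGraph (Fin n) => ∃ p : Fin n × Fin n,
        p.1 ≠ p.2 ∧ ¬ ∃ w, G.Adj p.1 w ∧ G.Adj p.2 w) := by
        refine pr_mono fun G hG => ?_
        contrapose! hG
        have hlt : ∀ u v, u ≠ v → ∃ w, G.Adj u w ∧ G.Adj v w := fun u v h => hG (u, v) h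
        intro u v
        rcases eq_or_ne u v with rfl | h
        -- For equal vertices only some neighbor is needed; a common neighbor with any other vertex
        -- provides one.
        · have : Nontrivial (Fin n) := Fin.nontrivial_iff_two_le.2 hn
          obtain ⟨v, hv⟩ := exists_ne u
          obtain ⟨w, hw, _⟩ := hlt u v hv.symm
          exact ⟨w, hw, hw⟩
        · exact hlt u v h
    _ ≤ Fintype.card (Fin n × Fin n) * (3 / 4) ^ (n - 2) := by
        refine pr_exists_le_card_mul _ fun p => ?_
        by_cases hp : p.1 = p.2
        · simp only [hp, ne_eq, not_true_eq_false, false_and]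
          simp only [pr, Finset.filter_false, Finset.card_empty, Nat.cast_zero, zero_div]
          positivity
        · simp only [ne_eq, hp, not_false_eq_true, true_and]
          simpa using pr_no_common_neighbor (V := Fin n) hp
    _ = _ := by
        obtain ⟨m, rfl⟩ := Nat.exists_eq_add_of_le hn
        simp only [Fintype.card_prod, Fintype.card_fin, Nat.add_sub_cancel_left]
        push_cast
        rw [pow_add]
        ring

open Classical in
/-- The vertices whose degrees differ from all other degrees by at least `6`. -/
noncomputable def degreeIsolated {V : Type*} [Fintype V] (G : SimpleGraph V) : Finset V :=
  Finset.univ.filter fun w => ∀ x, x ≠ w → G.degree x + 6 ≤ G.degree w ∨ G.degree w + 6 ≤ G.degree x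

open Classical in
-- A vertex of large degree that is not isolated is the first entry of a pair with close degrees.
lemma card_filter_le_degreeIsolated_add {V : Type*} [Fintype V] (G : SimpleGraph V) (T : ℕ) :
    (Finset.univ.filter fun v => T ≤ G.degree v).card ≤ (degreeIsolated G).card +
      (Finset.univ.filter fun p : V × V => p.1 ≠ p.2 ∧ T ≤ G.degree p.1 ∧
        G.degree p.1 ≤ G.degree p.2 + 5 ∧ G.degree p.2 ≤ G.degree p.1 + 5).card := by
  set Y := Finset.univ.filter fun p : V × V => p.1 ≠ p.2 ∧ T ≤ G.degree p.1 ∧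
        G.degree p.1 ≤ G.degree p.2 + 5 ∧ G.degree p.2 ≤ G.degree p.1 + 5 with hY
  calc _ ≤ (degreeIsolated G ∪ Y.image Prod.fst).card := by
        refine Finset.card_le_card fun w hw => ?_
        rw [Finset.mem_union, or_iff_not_imp_left]
        intro hI
        simp only [degreeIsolated, Finset.mem_filter, Finset.mem_univ, true_and] at hI hw
        push Not at hI
        obtain ⟨x, hxw, h1, h2⟩ := hI
        refine Finset.mem_image.2 ⟨(w, x), ?_, rfl⟩
        simp only [hY, Finset.mem_filter, Finset.mem_univ, true_and]
        exact ⟨hxw.symm, hw, by omega, by omega⟩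
    _ ≤ _ := (Finset.card_union_le _ _).trans (by gcongr; exact Finset.card_image_le)

open Classical in
-- With `p` the probability of degree at least S + 6, Chebyshev gives more than n * p / 2 such
-- vertices, and Markov leaves fewer than n * p / 4 close pairs. The difference is at least n * p /
-- 4, hence at least the scale.
lemma aas_scale_le_card_degreeIsolated :
    AAS fun n G => scale n ≤ (degreeIsolated G).card := by
  have hlim : Tendsto (fun n : ℕ => 90 / scale n) atTop (𝓝 0) :=
    tendsto_scale.const_div_atTop 90
  refine AAS.of_le hlim ?_
  filter_upwards [eventually_ge_atTop 2, tendsto_scale.eventually_ge_atTop 144,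
    eventually_pow_le_exp_scale 21] with n hn hx hexp
  set x := scale n with hxdef
  have hx0 : 0 < x := by linarith
  have hm2 : ((n - 2 : ℕ) : ℝ) + 2 = n := by
    rw [Nat.cast_sub hn]; push_cast; ring
  obtain ⟨S, hS1, hS2, hS3⟩ := exists_binomial_threshold (m := n - 2) hx
    (by rw [hm2, ← scale_pow n])
    (hexp.trans (Real.exp_le_exp.2 (by nlinarith)))
  rw [hm2] at hS2 hS3
  have hS : ∀ k, S ≤ k → binPMF (n - 2) k ≤ binPMF (n - 2) S :=
    fun k hk => binPMF_le_of_le hS1 hk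
  have hAB := binTail_eq_add (n - 2) (S + 5)
  have hb5 := hS (S + 5) (by omega)
  have hb50 := binPMF_nonneg (n - 2) (S + 5)
  have hB0 := binTail_nonneg (n - 2) (S + 5 + 1)
  set A := binTail (n - 2) (S + 5) with hA
  set B := binTail (n - 2) (S + 5 + 1) with hB
  set b := binPMF (n - 2) S with hb
  set b5 := binPMF (n - 2) (S + 5) with hb5def
  set p := (A + B) / 2 with hp
  have hn0 : (0 : ℝ) < n := by positivity
  have hb0 : 0 ≤ b := binPMF_nonneg _ _
  have hnp : 4 * x ≤ n * p := by
    rw [hp]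
    nlinarith
  have hp0 : 0 < p := by
    by_contra! h
    nlinarith
  have hnt : Nontrivial (Fin n) := Fin.nontrivial_iff_two_le.2 hn
  have hX : pr (fun G : SimpleGraph (Fin n) =>
      ((Finset.univ.filter fun v => S + 6 ≤ G.degree v).card : ℝ) ≤ n * p / 2) ≤ 2 / x := by
    -- The covariance is (A ^ 2 + B ^ 2) / 2 - ((A + B) / 2) ^ 2 = ((A - B) / 2) ^ 2, and A - B =
    -- b5.
    have h := pr_card_filter_le_half_le (Ω := SimpleGraph (Fin n)) (V := Fin n)
      (fun v G => S + 6 ≤ G.degree v) (p := p) (c := b5 ^ 2 / 4)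
      (by rw [Fintype.card_fin]; linarith) (by positivity)
      (fun v => by
        obtain ⟨w, hw⟩ := exists_ne v
        have := pr_le_degree hw.symm (S + 5)
        rwa [Fintype.card_fin] at this)
      (fun u v huv => by
        refine (pr_le_degree_and_le_degree huv (S + 5)).le.trans (le_of_eq ?_)
        rw [Fintype.card_fin, ← hA, ← hB, hp, show b5 = A - B by linarith]
        ring)
    rw [Fintype.card_fin] at h
    refine le_trans (le_of_eq ?_) (h.trans ?_)
    · congr! 7
    have hbp : b5 ≤ p / x := by
      rw [le_div_iff₀ hx0]
      have h1 : n * b5 ≤ 1 / x := le_trans (by gcongr) hS2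
      have h2 : 1 / x * x = 1 := by field_simp
      have h3 : n * (b5 * x) ≤ n * p := by nlinarith
      exact le_of_mul_le_mul_left h3 hn0
    have e1 : 4 / (n * p) ≤ 1 / x := by
      rw [div_le_div_iff₀ (by linarith) hx0]; linarith
    have e2 : 4 * (b5 ^ 2 / 4) / p ^ 2 ≤ 1 / x := by
      rw [div_le_iff₀ (by positivity)]
      calc 4 * (b5 ^ 2 / 4) = b5 ^ 2 := by ring
        _ ≤ (p / x) ^ 2 := by gcongr
        _ = 1 / x * (1 / x * p ^ 2) := by ring
        _ ≤ 1 / x * (1 * p ^ 2) := by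
            gcongr
            rw [div_le_one hx0]
            linarith
        _ = _ := by ring
    calc _ ≤ 1 / x + 1 / x := add_le_add e1 e2
      _ = _ := by ring
  have hY : pr (fun G : SimpleGraph (Fin n) => n * p / 4 ≤
      ((Finset.univ.filter fun w : Fin n × Fin n => w.1 ≠ w.2 ∧ S + 6 ≤ G.degree w.1 ∧
        G.degree w.1 ≤ G.degree w.2 + 5 ∧ G.degree w.2 ≤ G.degree w.1 + 5).card : ℝ))
      ≤ 88 / x := by
    have h := pr_card_filter_ge_le (Ω := SimpleGraph (Fin n)) (V := Fin n × Fin n)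
      (fun w G => w.1 ≠ w.2 ∧ S + 6 ≤ G.degree w.1 ∧
        G.degree w.1 ≤ G.degree w.2 + 5 ∧ G.degree w.2 ≤ G.degree w.1 + 5)
      (a := n * p / 4) (q := A * (11 * b)) (by linarith)
      (fun w => by
        by_cases hw : w.1 = w.2
        · simp only [hw, ne_eq, not_true_eq_false, false_and]
          simp only [pr, Finset.filter_false, Finset.card_empty, Nat.cast_zero, zero_div]
          have : 0 ≤ A := binTail_nonneg _ _
          positivity
        · simp only [ne_eq, hw, not_false_eq_true, true_and]
          have := pr_degree_close_le (V := Fin n) hw (S := S) (by simpa using hS)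
          simpa using this)
    refine le_trans (le_of_eq ?_) (h.trans ?_)
    · congr! 7
    rw [Fintype.card_prod, Fintype.card_fin, div_le_div_iff₀ (by linarith) hx0]
    push_cast
    have h1 : n * b * x ≤ 1 := by
      have h2 : 1 / x * x = 1 := by field_simp
      nlinarith
    have hA2 : A ≤ 2 * p := by rw [hp]; linarith
    have hA0 : 0 ≤ A := binTail_nonneg _ _
    calc (n : ℝ) * n * (A * (11 * b)) * x = 11 * (n * A) * (n * b * x) := by ring
      _ ≤ 11 * (n * (2 * p)) * 1 := by gcongr
      _ = _ := by ring
  calc _ ≤ pr (fun G : SimpleGraph (Fin n) =>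
      ((Finset.univ.filter fun v => S + 6 ≤ G.degree v).card : ℝ) ≤ n * p / 2 ∨
      n * p / 4 ≤
      ((Finset.univ.filter fun w : Fin n × Fin n => w.1 ≠ w.2 ∧ S + 6 ≤ G.degree w.1 ∧
        G.degree w.1 ≤ G.degree w.2 + 5 ∧ G.degree w.2 ≤ G.degree w.1 + 5).card : ℝ)) := by
        refine pr_mono fun G hG => ?_
        contrapose! hG
        have h := card_filter_le_degreeIsolated_add G (S + 6)
        have h' : ((Finset.univ.filter fun v => S + 6 ≤ G.degree v).card : ℝ) ≤
          (degreeIsolated G).card +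
          (Finset.univ.filter fun p : Fin n × Fin n => p.1 ≠ p.2 ∧ S + 6 ≤ G.degree p.1 ∧
          G.degree p.1 ≤ G.degree p.2 + 5 ∧ G.degree p.2 ≤ G.degree p.1 + 5).card := by
          exact_mod_cast h
        linarith [hG.1, hG.2]
    _ ≤ 2 / x + 88 / x := (pr_or_le _ _).trans (add_le_add hX hY)
    _ = _ := by ring

/-! ### Almost all graphs are identified by the degrees of neighbors -/

section Separated

open Classical

variable {V : Type*} [Fintype V]

/-- The number of neighbors of `w` other than `u` and `v`. -/
noncomputable def degreeAway (u v : V) (G : SimpleGraph V) (w : V) : ℕ :=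
  (Finset.univ.filter fun y => y ≠ u ∧ y ≠ v ∧ G.Adj w y).card

/-- The vertices whose degree in the graph without `u` and `v` differs from all other such degrees
by at least `3`. -/
noncomputable def separatedAway (u v : V) (G : SimpleGraph V) : Finset V :=
  Finset.univ.filter fun w => w ≠ u ∧ w ≠ v ∧ ∀ x, x ≠ u → x ≠ v → x ≠ w →
    degreeAway u v G x + 3 ≤ degreeAway u v G w ∨ degreeAway u v G w + 3 ≤ degreeAway u v G x

lemma mem_separatedAway {u v w : V} {G : SimpleGraph V} :
    w ∈ separatedAway u v G ↔ w ≠ u ∧ w ≠ v ∧ ∀ x, x ≠ u → x ≠ v → x ≠ w →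
      degreeAway u v G x + 3 ≤ degreeAway u v G w ∨
        degreeAway u v G w + 3 ≤ degreeAway u v G x := by
  simp [separatedAway]

lemma degreeAway_le_degree (u v : V) (G : SimpleGraph V) (w : V) :
    degreeAway u v G w ≤ G.degree w := by
  rw [← SimpleGraph.card_neighborFinset_eq_degree]
  refine Finset.card_le_card fun y hy => ?_
  simpa using (Finset.mem_filter.1 hy).2.2.2

lemma degree_le_degreeAway_add_two (u v : V) (G : SimpleGraph V) (w : V) :
    G.degree w ≤ degreeAway u v G w + 2 := by
  rw [← SimpleGraph.card_neighborFinset_eq_degree]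
  calc _ ≤ ((Finset.univ.filter fun y => y ≠ u ∧ y ≠ v ∧ G.Adj w y) ∪ {u, v}).card := by
        refine Finset.card_le_card fun y hy => ?_
        have : G.Adj w y := by simpa using hy
        simp only [Finset.mem_union, Finset.mem_filter, Finset.mem_univ, true_and,
          Finset.mem_insert, Finset.mem_singleton, this, and_true]
        tauto
    _ ≤ _ := (Finset.card_union_le _ _).trans (by
        unfold degreeAway; gcongr; exact Finset.card_le_two)

/-- Dropping `u` and `v` lowers each degree by at most 2, so a gap of 6 stays at least 3. A gap of 3
in turn survives when the edges at `u` and `v` are put back. -/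
lemma degreeIsolated_sdiff_subset [DecidableEq V] (u v : V) (G : SimpleGraph V) :
    degreeIsolated G \ {u, v} ⊆ separatedAway u v G := by
  intro w hw
  simp only [degreeIsolated, Finset.mem_sdiff, Finset.mem_filter, Finset.mem_univ, true_and,
    Finset.mem_insert, Finset.mem_singleton, not_or] at hw
  obtain ⟨h, hu, hv⟩ := hw
  simp only [mem_separatedAway]
  refine ⟨hu, hv, fun x _ _ hx => ?_⟩
  have h1 := h x hx
  have := degreeAway_le_degree u v G w
  have := degreeAway_le_degree u v G x
  have := degree_le_degreeAway_add_two u v G w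
  have := degree_le_degreeAway_add_two u v G x
  omega

/-- The star with center `u` and set of leaves `Z \ {u}`. -/
def starGraph {V : Type*} (u : V) (Z : Finset V) : SimpleGraph V :=
  SimpleGraph.fromRel fun a b => a = u ∧ b ∈ Z

lemma symmDiff_starGraph_adj {V : Type*} {u w : V} {Z : Finset V} {G : SimpleGraph V} (hw : w ≠ u) :
    (symmDiff G (starGraph u Z)).Adj u w ↔ ¬ (G.Adj u w ↔ w ∈ Z) := by
  have : (starGraph u Z).Adj u w ↔ w ∈ Z := by
    simp [starGraph, SimpleGraph.fromRel_adj, hw, hw.symm]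
  simp only [symmDiff, SimpleGraph.sup_adj, SimpleGraph.sdiff_adj, this]
  tauto

lemma symmDiff_starGraph_adj_of_ne {V : Type*} {u x y : V} {Z : Finset V} {G : SimpleGraph V} (hx : x ≠ u)
    (hy : y ≠ u) : (symmDiff G (starGraph u Z)).Adj x y ↔ G.Adj x y := by
  have : ¬ (starGraph u Z).Adj x y := by
    simp [starGraph, SimpleGraph.fromRel_adj, hx, hy]
  simp only [symmDiff, SimpleGraph.sup_adj, SimpleGraph.sdiff_adj, this]
  tauto

/-- A star at `u` alters only edges at `u`, which `degreeAway` ignores. Hence the edges from `u` to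
separated vertices may be rerandomized. -/
lemma separatedAway_symmDiff_starGraph (u v : V) (G : SimpleGraph V) (Z : Finset V) :
    separatedAway u v (symmDiff G (starGraph u Z)) = separatedAway u v G := by
  have h : ∀ w, w ≠ u →
      degreeAway u v (symmDiff G (starGraph u Z)) w = degreeAway u v G w := by
    intro w hw
    unfold degreeAway
    congr 1
    ext y
    simp only [Finset.mem_filter, Finset.mem_univ, true_and]
    refine and_congr_right fun hy => ?_
    rw [symmDiff_starGraph_adj_of_ne hw hy]
  ext w
  simp only [mem_separatedAway]
  refine and_congr_right fun hw => and_congr_right fun _ => ?_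
  refine forall_congr' fun x => ?_
  refine imp_congr_right fun hx => ?_
  rw [h w hw, h x hx]

/-- It is unlikely that two vertices agree on all but two of the many separated vertices. -/
lemma pr_agree_on_separatedAway_le [DecidableEq V] {u v : V} (huv : u ≠ v) (e₁ e₂ : V) (K : ℕ) :
    pr (fun G : SimpleGraph V => K ≤ (separatedAway u v G \ {e₁, e₂}).card ∧
      ∀ w ∈ separatedAway u v G \ {e₁, e₂}, G.Adj u w ↔ G.Adj v w) ≤ 1 / 2 ^ K := by
  let J : SimpleGraph V → Finset V := fun G => separatedAway u v G \ {e₁, e₂}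
  have hJ : ∀ G Z, J (symmDiff G (starGraph u Z)) = J G := fun G Z => by
    simp only [J, separatedAway_symmDiff_starGraph]
  set B : Finset (SimpleGraph V) := Finset.univ.filter fun G => K ≤ (J G).card ∧
    ∀ w ∈ J G, G.Adj u w ↔ G.Adj v w with hB
  have hne : ∀ G, ∀ w ∈ J G, w ≠ u ∧ w ≠ v := by
    intro G w hw
    have := mem_separatedAway.1 (Finset.mem_sdiff.1 hw).1
    exact ⟨this.1, this.2.1⟩
  -- In a bad graph `u` and `v` agree on `J G`, so after toggling along `Z` the set `Z` is exactly
  -- where they disagree. Thus the pair of `G` and `Z` can be recovered, and each bad graph accounts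
  -- for at least 2 ^ K graphs.
  have hrec : ∀ G ∈ B, ∀ Z ∈ (J G).powerset,
      Z = (J (symmDiff G (starGraph u Z))).filter fun w =>
        ¬ ((symmDiff G (starGraph u Z)).Adj u w ↔ (symmDiff G (starGraph u Z)).Adj v w) := by
    intro G hG Z hZ
    have hG := (Finset.mem_filter.1 hG).2.2
    rw [Finset.mem_powerset] at hZ
    ext w
    rw [Finset.mem_filter, hJ]
    by_cases hw : w ∈ J G
    · rw [symmDiff_starGraph_adj (hne G w hw).1,
        symmDiff_starGraph_adj_of_ne huv.symm (hne G w hw).1, hG w hw]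
      tauto
    · exact iff_of_false (fun h => hw (hZ h)) fun h => hw h.1
  have hcard : (B.sigma fun G => (J G).powerset).card ≤ Fintype.card (SimpleGraph V) := by
    refine (Finset.card_le_card_of_injOn (t := Finset.univ)
      (fun x => symmDiff x.1 (starGraph u x.2)) (fun _ _ => by simp) ?_)
    rintro ⟨G, Z⟩ h ⟨G', Z'⟩ h' heq
    simp only [Finset.coe_sigma, Set.mem_sigma_iff, Finset.mem_coe] at h h'
    dsimp only at heq
    have hZ : Z = Z' := by
      rw [hrec G h.1 Z h.2, hrec G' h'.1 Z' h'.2, heq]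
    subst hZ
    rw [symmDiff_left_injective _ heq]
  rw [Finset.card_sigma] at hcard
  have hle : B.card * 2 ^ K ≤ Fintype.card (SimpleGraph V) := by
    refine le_trans ?_ hcard
    rw [← smul_eq_mul]
    refine Finset.card_nsmul_le_sum _ _ _ fun G hG => ?_
    rw [Finset.card_powerset]
    exact Nat.pow_le_pow_right (by norm_num) (Finset.mem_filter.1 hG).2.1
  have : (0 : ℝ) < Fintype.card (SimpleGraph V) := by exact_mod_cast Fintype.card_pos
  rw [pr_def, div_le_div_iff₀ this (by positivity), one_mul]
  refine le_trans (le_of_eq ?_) (show ((B.card * 2 ^ K : ℕ) : ℝ) ≤ _ by exact_mod_cast hle)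
  push_cast
  congr! 3

/-- The set of the degrees of the neighbors of `v`. -/
def neighborDegrees (G : SimpleGraph V) (v : V) : Set ℕ :=
  {k | ∃ w, G.Adj v w ∧ G.degree w = k}

/-- Among the vertices other than `u` and `v`, a separated vertex is determined by its degree. Only
`u` and `v` themselves can imitate that degree, each for at most one separated vertex; these are
`e₁` and `e₂`. -/
lemma exists_agree_of_neighborDegrees_eq [DecidableEq V] {G : SimpleGraph V} {u v : V}
    (h : neighborDegrees G u = neighborDegrees G v) :
    ∃ e₁ e₂, ∀ w ∈ separatedAway u v G \ {e₁, e₂}, G.Adj u w ↔ G.Adj v w := by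
  have huniq : ∀ w ∈ separatedAway u v G, ∀ x, x ≠ u → x ≠ v → G.degree x = G.degree w → x = w := by
    intro w hw x hxu hxv hd
    by_contra hx
    have h1 := (mem_separatedAway.1 hw).2.2 x hxu hxv hx
    have := degreeAway_le_degree u v G w
    have := degreeAway_le_degree u v G x
    have := degree_le_degreeAway_add_two u v G w
    have := degree_le_degreeAway_add_two u v G x
    omega
  have hex : ∀ a, ∃ e, ∀ w ∈ separatedAway u v G, w ≠ e → G.degree w ≠ G.degree a := by
    intro a
    by_cases ha : ∃ e ∈ separatedAway u v G, G.degree e = G.degree a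
    · obtain ⟨e, he, hea⟩ := ha
      refine ⟨e, fun w hw hwe hwa => hwe ?_⟩
      have := mem_separatedAway.1 hw
      exact huniq e he w this.1 this.2.1 (hwa.trans hea.symm)
    · push Not at ha
      exact ⟨a, fun w hw _ => ha w hw⟩
  obtain ⟨e₁, h₁⟩ := hex u
  obtain ⟨e₂, h₂⟩ := hex v
  refine ⟨e₁, e₂, fun w hw => ?_⟩
  simp only [Finset.mem_sdiff, Finset.mem_insert, Finset.mem_singleton, not_or] at hw
  obtain ⟨hw, hw1, hw2⟩ := hw
  have key : ∀ a, G.degree w ∈ neighborDegrees G a → G.Adj a w := by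
    rintro a ⟨y, hy, hd⟩
    have hyu : y ≠ u := by rintro rfl; exact h₁ w hw hw1 hd.symm
    have hyv : y ≠ v := by rintro rfl; exact h₂ w hw hw2 hd.symm
    rwa [huniq w hw y hyu hyv hd] at hy
  constructor
  · exact fun ha => key v (h ▸ ⟨w, ha, rfl⟩)
  · exact fun ha => key u (h ▸ ⟨w, ha, rfl⟩)

lemma aas_neighborDegrees_injective :
    AAS fun _ G => Function.Injective (neighborDegrees G) := by
  have hlim : Tendsto (fun n : ℕ => pr (fun G : SimpleGraph (Fin n) =>
      ¬ scale n ≤ (degreeIsolated G).card) +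
      16 * (scale n ^ 80 * Real.exp (-Real.log 2 * scale n))) atTop (𝓝 0) := by
    simpa using (aas_iff.1 aas_scale_le_card_degreeIsolated).add
      ((tendsto_pow_mul_exp_neg_scale (Real.log_pos one_lt_two) 80).const_mul 16)
  refine AAS.of_le hlim (.of_forall fun n => ?_)
  -- Two vertices are lost for `u` and `v` and two for the exceptions; the resulting 2 ^ 4 is the
  -- factor 16 in the bound.
  set K := ⌈scale n⌉₊ - 4 with hK
  calc _ ≤ pr (fun G : SimpleGraph (Fin n) => ¬ scale n ≤ (degreeIsolated G).card ∨
        ∃ p : Fin n × Fin n × Fin n × Fin n, p.1 ≠ p.2.1 ∧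
          K ≤ (separatedAway p.1 p.2.1 G \ {p.2.2.1, p.2.2.2}).card ∧
          ∀ w ∈ separatedAway p.1 p.2.1 G \ {p.2.2.1, p.2.2.2}, G.Adj p.1 w ↔ G.Adj p.2.1 w) := by
        refine pr_mono fun G hG => ?_
        rw [or_iff_not_imp_left, not_not]
        intro hI
        simp only [Function.Injective, not_forall] at hG
        obtain ⟨u, v, h, huv⟩ := hG
        obtain ⟨e₁, e₂, he⟩ := exists_agree_of_neighborDegrees_eq h
        refine ⟨(u, v, e₁, e₂), huv, ?_, he⟩
        have h1 : ⌈scale n⌉₊ ≤ (degreeIsolated G).card := Nat.ceil_le.2 hI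
        have h2 := Finset.card_le_card (degreeIsolated_sdiff_subset u v G)
        have h3 := Finset.le_card_sdiff {u, v} (degreeIsolated G)
        have h4 := Finset.le_card_sdiff {e₁, e₂} (separatedAway u v G)
        have h5 : ({u, v} : Finset (Fin n)).card ≤ 2 := Finset.card_le_two
        have h6 : ({e₁, e₂} : Finset (Fin n)).card ≤ 2 := Finset.card_le_two
        have h7 : K ≤ (separatedAway u v G \ {e₁, e₂}).card := by omega
        exact h7
    _ ≤ _ := (pr_or_le _ _).trans (add_le_add le_rfl ?_)
  calc _ ≤ Fintype.card (Fin n × Fin n × Fin n × Fin n) * (1 / 2 ^ K : ℝ) := by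
        refine pr_exists_le_card_mul _ fun p => ?_
        by_cases hp : p.1 = p.2.1
        · simp only [hp, ne_eq, not_true_eq_false, false_and]
          simp only [pr, Finset.filter_false, Finset.card_empty, Nat.cast_zero, zero_div]
          positivity
        · simp only [ne_eq, hp, not_false_eq_true, true_and]
          exact pr_agree_on_separatedAway_le hp _ _ K
    _ = scale n ^ 80 * (1 / 2 ^ K) := by
        simp only [Fintype.card_prod, Fintype.card_fin]
        push_cast
        rw [← scale_pow n]
        ring
    _ ≤ scale n ^ 80 * (16 * Real.exp (-Real.log 2 * scale n)) := by
        have : 0 ≤ scale n := Real.rpow_nonneg (Nat.cast_nonneg n) _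
        gcongr
        rw [neg_mul, Real.exp_neg, ← Real.rpow_def_of_pos two_pos, ← div_eq_mul_inv,
          div_le_div_iff₀ (by positivity) (by positivity), one_mul]
        calc (2 : ℝ) ^ scale n ≤ (2 : ℝ) ^ ((K + 4 : ℕ) : ℝ) := by
              refine Real.rpow_le_rpow_of_exponent_le one_le_two ((Nat.le_ceil _).trans ?_)
              exact_mod_cast (by omega)
          _ = _ := by rw [Real.rpow_natCast, pow_add]; norm_num; ring
    _ = _ := by ring

end Separated

/-! ### A sound set-broadcast algorithm with four rounds -/

/-- The name of a vertex, namely the set of degrees of its neighbors, with the names of its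
neighbors. -/
abbrev Report := Set ℕ × Set (Set ℕ)

/-- The graph on names that a set of reports describes. -/
def reportGraph (K : Set Report) : SimpleGraph (Prod.fst '' K) :=
  SimpleGraph.fromRel fun a b => ∃ B, (a.1, B) ∈ K ∧ b.1 ∈ B

open Classical in
/-- The output of the vertex with name `a` that has collected the reports `K`. -/
noncomputable def reportOutput (P : GraphProblem) (n : ℕ) (a : Set ℕ) (K : Set Report) :
    NodeOutput P.Label :=
  if h : (Prod.fst '' K).Finite ∧ (Prod.fst '' K).ncard = n ∧ a ∈ Prod.fst '' K then
    haveI : Finite (Prod.fst '' K) := h.1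
    -- The common-neighbor test rules out that another vertex has collected less and fails. The
    -- chosen solution depends on `K` alone, so vertices with equal reports choose consistently.
    if h' : HasCommonNeighbors (reportGraph K) ∧ (P.solutions (reportGraph K)).Nonempty then
      .label (h'.2.some ⟨a, h.2.2⟩)
    else .failed
  else .failed

/-- The states, which are also the messages, of the four-round set-broadcast algorithm. -/
inductive CollectState (Γ : Type) where
  | start (n d : ℕ)
  | named (n : ℕ) (a : Set ℕ)
  | reporting (n : ℕ) (r : Report)
  | collecting (n : ℕ) (a : Set ℕ) (K : Set Report)
  | done (o : NodeOutput Γ)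

open CollectState in
/-- The new state of a vertex in the four-round set-broadcast algorithm. -/
noncomputable def collectUpdate (P : GraphProblem) (I : Set (CollectState P.Label)) :
    CollectState P.Label → CollectState P.Label
  | start n _ => named n {d | start n d ∈ I}
  | named n a => reporting n (a, {b | named n b ∈ I})
  | reporting n r => collecting n r.1 {q | reporting n q ∈ I}
  | collecting n a _ => done (reportOutput P n a {q | ∃ b K, collecting n b K ∈ I ∧ q ∈ K})
  | done o => done o

/-- The four-round set-broadcast algorithm: the nodes compute names from the degrees of their
neighbors, exchange names, and collect the whole graph. -/
noncomputable def collectAlgorithm (P : GraphProblem) : Algorithm SB P.Label where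
  State := CollectState P.Label
  Msg := CollectState P.Label
  init := .start
  send := id
  update s I := collectUpdate P I s
  output s := match s with
    | .done o => some o
    | _ => none

section Collect

open Classical

variable {V : Type} [Fintype V] (G : SimpleGraph V)

/-- The report of the vertex `v`. -/
def vertexReport (v : V) : Report :=
  (neighborDegrees G v, neighborDegrees G '' G.neighborSet v)

/-- The reports of the vertices that are reached by walks of length two from `v`. -/
def collectedReports (v : V) : Set Report :=
  {q | ∃ u, G.Adj v u ∧ ∃ w, G.Adj u w ∧ q = vertexReport G w}

variable (P : GraphProblem)

lemma SB_receive_mem {Γ : Type} (A : Algorithm SB Γ) (s : V → A.State) (v : V) (x : A.Msg) :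
    x ∈ (show Set A.Msg from SB.receive ((G.neighborFinset v).val.filterMap
      fun u => A.outgoing (s u))) ↔ ∃ u, G.Adj v u ∧ A.outgoing (s u) = some x := by
  change x ∈ ((G.neighborFinset v).val.filterMap fun u => A.outgoing (s u)) ↔ _
  simp [Multiset.mem_filterMap]

lemma collect_stateAfter_one (v : V) :
    (collectAlgorithm P).stateAfter G 1 v =
      .named (Fintype.card V) (neighborDegrees G v) := by
  change CollectState.named _ _ = _
  congr 1
  ext d
  refine (SB_receive_mem G (collectAlgorithm P) _ v _).trans ?_
  simp only [neighborDegrees, Set.mem_ofPred_eq]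
  refine exists_congr fun u => and_congr_right fun _ => ?_
  change (some (.start (Fintype.card V) (G.degree u)) : Option (CollectState P.Label)) =
    some (.start (Fintype.card V) d) ↔ _
  simp

lemma collect_stateAfter_two (v : V) :
    (collectAlgorithm P).stateAfter G 2 v =
      .reporting (Fintype.card V) (vertexReport G v) := by
  have h := collect_stateAfter_one G P
  unfold Algorithm.stateAfter
  rw [h]
  change CollectState.reporting _ (_, _) = _
  unfold vertexReport
  congr 2
  ext d
  refine (SB_receive_mem G (collectAlgorithm P) _ v _).trans ?_
  simp only [Set.mem_image, SimpleGraph.mem_neighborSet]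
  refine exists_congr fun u => and_congr_right fun _ => ?_
  rw [h]
  change (some (.named _ _) : Option (CollectState P.Label)) = some (.named _ _) ↔ _
  simp

lemma collect_stateAfter_three (v : V) :
    (collectAlgorithm P).stateAfter G 3 v =
      .collecting (Fintype.card V) (neighborDegrees G v)
        (vertexReport G '' G.neighborSet v) := by
  have h := collect_stateAfter_two G P
  unfold Algorithm.stateAfter
  rw [h]
  change CollectState.collecting _ _ _ = _
  congr 1
  ext d
  refine (SB_receive_mem G (collectAlgorithm P) _ v _).trans ?_
  simp only [Set.mem_image, SimpleGraph.mem_neighborSet]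
  refine exists_congr fun u => and_congr_right fun _ => ?_
  rw [h]
  change (some (.reporting _ _) : Option (CollectState P.Label)) = some (.reporting _ _) ↔ _
  simp

lemma collect_stateAfter_four (v : V) :
    (collectAlgorithm P).stateAfter G 4 v =
      .done (reportOutput P (Fintype.card V) (neighborDegrees G v) (collectedReports G v)) := by
  have h := collect_stateAfter_three G P
  unfold Algorithm.stateAfter
  rw [h]
  change CollectState.done (reportOutput _ _ _ _) = _
  congr 2
  ext q
  simp only [collectedReports, Set.mem_ofPred_eq]
  constructor
  · rintro ⟨b, K, hm, hq⟩
    obtain ⟨u, hu, he⟩ := (SB_receive_mem G (collectAlgorithm P) _ v _).1 hm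
    rw [h] at he
    change (some (.collecting _ _ _) : Option (CollectState P.Label)) = some (.collecting _ _ _) at he
    simp only [Option.some.injEq, CollectState.collecting.injEq, true_and] at he
    rw [← he.2] at hq
    obtain ⟨w, hw, rfl⟩ := hq
    exact ⟨u, hu, w, hw, rfl⟩
  · rintro ⟨u, hu, w, hw, rfl⟩
    refine ⟨neighborDegrees G u, vertexReport G '' G.neighborSet u,
      (SB_receive_mem G (collectAlgorithm P) _ v _).2 ⟨u, hu, ?_⟩, ⟨w, hw, rfl⟩⟩
    rw [h]
    rfl

lemma collect_outputsWithin_iff (τ : V → NodeOutput P.Label) :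
    (collectAlgorithm P).OutputsWithin G 4 τ ↔
      ∀ v, reportOutput P (Fintype.card V) (neighborDegrees G v) (collectedReports G v) = τ v := by
  unfold Algorithm.OutputsWithin
  refine forall_congr' fun v => ?_
  rw [collect_stateAfter_four]
  change some _ = some _ ↔ _
  simp

variable {G}

/-- If the names are distinct, then the reports of all vertices describe the graph. -/
noncomputable def reportIso (h : Function.Injective (neighborDegrees G)) :
    G ≃g reportGraph (Set.range (vertexReport G)) where
  toEquiv := Equiv.ofBijective
    (fun v => ⟨neighborDegrees G v, vertexReport G v, ⟨v, rfl⟩, rfl⟩)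
    ⟨fun u v huv => h (congrArg Subtype.val huv), by
      rintro ⟨_, _, ⟨v, rfl⟩, rfl⟩
      exact ⟨v, rfl⟩⟩
  map_rel_iff' := by
    intro u v
    have key : ∀ a b, (∃ B, (neighborDegrees G a, B) ∈ Set.range (vertexReport G) ∧
        neighborDegrees G b ∈ B) ↔ G.Adj a b := by
      intro a b
      constructor
      · rintro ⟨B, ⟨w, hw⟩, hb⟩
        simp only [vertexReport, Prod.mk.injEq] at hw
        obtain rfl := h hw.1
        rw [← hw.2] at hb
        obtain ⟨x, hx, hxb⟩ := hb
        rwa [h hxb] at hx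
      · intro hab
        exact ⟨_, ⟨a, rfl⟩, b, hab, rfl⟩
    refine (SimpleGraph.fromRel_adj _ _ _).trans ?_
    constructor
    · rintro ⟨_, h' | h'⟩
      exacts [(key u v).1 h', ((key v u).1 h').symm]
    · exact fun hab => ⟨fun e => hab.ne (h (congrArg Subtype.val e)), Or.inl ((key u v).2 hab)⟩

lemma HasCommonNeighbors.iso_iff {V W : Type*} {G : SimpleGraph V} {H : SimpleGraph W}
    (φ : G ≃g H) : HasCommonNeighbors G ↔ HasCommonNeighbors H := by
  constructor
  · intro h u v
    obtain ⟨w, hu, hv⟩ := h (φ.symm u) (φ.symm v)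
    exact ⟨φ w, by simpa using φ.map_adj_iff.2 hu, by simpa using φ.map_adj_iff.2 hv⟩
  · intro h u v
    obtain ⟨w, hu, hv⟩ := h (φ u) (φ v)
    exact ⟨φ.symm w, by simpa using φ.symm.map_adj_iff.2 hu,
      by simpa using φ.symm.map_adj_iff.2 hv⟩

lemma collectedReports_eq_range (h : HasCommonNeighbors G) (v : V) :
    collectedReports G v = Set.range (vertexReport G) := by
  ext q
  constructor
  · rintro ⟨_, _, w, _, rfl⟩
    exact ⟨w, rfl⟩
  · rintro ⟨w, rfl⟩
    obtain ⟨u, hv, hw⟩ := h v w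
    exact ⟨u, hv, w, hw.symm, rfl⟩

/-- A vertex that has collected `n` names knows that the names are distinct and that it has
collected all reports. -/
lemma injective_and_collectedReports_eq {v : V}
    (h : (Prod.fst '' collectedReports G v).ncard = Fintype.card V) :
    Function.Injective (neighborDegrees G) ∧
      collectedReports G v = Set.range (vertexReport G) := by
  set W : Finset V := Finset.univ.filter fun w => ∃ u, G.Adj v u ∧ G.Adj u w with hW
  have e : Prod.fst '' collectedReports G v = (W.image (neighborDegrees G) : Finset _) := by
    ext a
    simp only [collectedReports, Set.mem_image, Set.mem_ofPred_eq, Finset.coe_image, hW,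
      Finset.coe_filter, Finset.mem_univ, true_and]
    constructor
    · rintro ⟨_, ⟨u, hu, w, hw, rfl⟩, rfl⟩
      exact ⟨w, ⟨u, hu, hw⟩, rfl⟩
    · rintro ⟨w, ⟨u, hu, hw⟩, rfl⟩
      exact ⟨_, ⟨u, hu, w, hw, rfl⟩, rfl⟩
  rw [e, Set.ncard_coe_finset] at h
  have h1 : (W.image (neighborDegrees G)).card ≤ W.card := Finset.card_image_le
  have h2 : W.card ≤ Fintype.card V := Finset.card_le_univ W
  -- The number of names is at most the number of vertices reached, which is at most the number of
  -- all vertices; equality at the ends forces both equalities.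
  have hWu : W = Finset.univ := (Finset.card_eq_iff_eq_univ W).1 (by omega)
  have hinj : Set.InjOn (neighborDegrees G) W := Finset.card_image_iff.1 (by omega)
  refine ⟨fun a b hab => hinj (by simp [hWu]) (by simp [hWu]) hab, ?_⟩
  ext q
  constructor
  · rintro ⟨_, _, w, _, rfl⟩
    exact ⟨w, rfl⟩
  · rintro ⟨w, rfl⟩
    have : w ∈ W := by simp [hWu]
    obtain ⟨u, hu, hw⟩ := (Finset.mem_filter.1 this).2
    exact ⟨u, hu, w, hw, rfl⟩

lemma GraphProblem.IsomorphismInvariant.solutions_nonempty_iff {P : GraphProblem}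
    (hP : P.IsomorphismInvariant) {V W : Type} [Finite V] [Finite W] {G : SimpleGraph V}
    {H : SimpleGraph W} (φ : G ≃g H) :
    (P.solutions G).Nonempty ↔ (P.solutions H).Nonempty := by
  rw [hP V W G H φ]
  constructor
  · rintro ⟨_, σ, hσ, rfl⟩
    exact ⟨σ, hσ⟩
  · rintro ⟨σ, hσ⟩
    exact ⟨_, σ, hσ, rfl⟩

variable {P}

lemma collect_solvesOn (hP : P.IsomorphismInvariant) (hG : HasCommonNeighbors G)
    (hinj : Function.Injective (neighborDegrees G)) (hsol : (P.solutions G).Nonempty) :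
    (collectAlgorithm P).SolvesOn G 4 := by
  set K := Set.range (vertexReport G) with hK
  set φ := reportIso hinj with hφ
  have hfin : Finite (Prod.fst '' K) := Finite.of_equiv V φ.toEquiv
  have hcard : (Prod.fst '' K).ncard = Fintype.card V := by
    rw [← Nat.card_coe_set_eq, ← Nat.card_eq_fintype_card]
    exact (Nat.card_congr φ.toEquiv).symm
  have h' : HasCommonNeighbors (reportGraph K) ∧ (P.solutions (reportGraph K)).Nonempty :=
    ⟨(HasCommonNeighbors.iso_iff φ).1 hG, (hP.solutions_nonempty_iff φ).1 hsol⟩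
  refine ⟨h'.2.some ∘ φ, ?_, (collect_outputsWithin_iff G P _).2 fun v => ?_⟩
  · rw [hP _ _ G _ φ]
    exact ⟨_, h'.2.some_mem, rfl⟩
  · rw [collectedReports_eq_range hG v]
    have h : (Prod.fst '' K).Finite ∧ (Prod.fst '' K).ncard = Fintype.card V ∧
        neighborDegrees G v ∈ Prod.fst '' K := ⟨hfin, hcard, _, ⟨v, rfl⟩, rfl⟩
    unfold reportOutput
    rw [dif_pos h, dif_pos h']
    rfl

/-- A single vertex that outputs a label certifies all three properties: its reports are then
complete and describe an isomorphic copy of the graph. -/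
lemma collect_failed (hP : P.IsomorphismInvariant)
    (hG : ¬ (HasCommonNeighbors G ∧ Function.Injective (neighborDegrees G) ∧
      (P.solutions G).Nonempty)) :
    (collectAlgorithm P).OutputsWithin G 4 fun _ => NodeOutput.failed := by
  rw [collect_outputsWithin_iff]
  intro v
  unfold reportOutput
  split_ifs with h h'
  · exfalso
    obtain ⟨hinj, hK⟩ := injective_and_collectedReports_eq h.2.1
    have hfin : Finite (Prod.fst '' collectedReports G v) := h.1
    refine hG ⟨?_, hinj, ?_⟩
    · have := h'.1
      rw [hK] at this
      exact (HasCommonNeighbors.iso_iff (reportIso hinj)).2 this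
    · obtain ⟨ψ⟩ : Nonempty (G ≃g reportGraph (collectedReports G v)) := by
        rw [hK]
        exact ⟨reportIso hinj⟩
      exact (hP.solutions_nonempty_iff ψ).2 h'.2
  · rfl
  · rfl

lemma collectAlgorithm_isSound (hP : P.IsomorphismInvariant)
    (hsol : AAS fun _ G => (P.solutions G).Nonempty) : (collectAlgorithm P).IsSound 4 where
  halts V _ G := ⟨_, (collect_outputsWithin_iff G P _).2 fun _ => rfl⟩
  solves := by
    refine ((aas_hasCommonNeighbors.and aas_neighborDegrees_injective).and hsol).mono
      (.of_forall fun n G h => collect_solvesOn hP h.1.1 h.1.2 h.2)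
  failed_of_not_solved V _ G h :=
    collect_failed hP fun hG => h (collect_solvesOn hP hG.1 hG.2.1 hG.2.2)

end Collect

lemma nonuniformSound_subset_solvableALL (M : BroadcastModel) (r : ℕ) :
    nonuniformSound M r ⊆ solvableALL := by
  rintro P ⟨hP, A, hA⟩
  exact ⟨hP, hA.solves.mono (.of_forall fun n G ⟨σ, hσ, _⟩ => ⟨σ, hσ⟩)⟩

lemma solvableALL_eq_nonuniformSound_SB : solvableALL = nonuniformSound SB 4 :=
  Set.Subset.antisymm
    (fun _ hP => ⟨hP.1, _, collectAlgorithm_isSound hP.1.1 hP.2⟩)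
    (nonuniformSound_subset_solvableALL SB 4)

/-! ### The problem of computing the isomorphism type of the component -/

/-- The isomorphism type of a finite graph, represented by the graphs on initial segments of `ℕ`
that are isomorphic to it. -/
def isoType {V : Type} (G : SimpleGraph V) : Set (Σ k : ℕ, SimpleGraph (Fin k)) :=
  {p | Nonempty (p.2 ≃g G)}

lemma isoType_eq_of_iso {V W : Type} {G : SimpleGraph V} {H : SimpleGraph W} (φ : G ≃g H) :
    isoType G = isoType H := by
  ext p
  exact ⟨fun ⟨ψ⟩ => ⟨ψ.trans φ⟩, fun ⟨ψ⟩ => ⟨ψ.trans φ.symm⟩⟩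

/-- The isomorphism type of the component of a vertex. -/
def componentType {V : Type} (G : SimpleGraph V) (v : V) : Set (Σ k : ℕ, SimpleGraph (Fin k)) :=
  isoType (G.induce (G.connectedComponentMk v).supp)

lemma componentType_iso {V W : Type} {G : SimpleGraph V} {H : SimpleGraph W} (φ : G ≃g H) (v : V) :
    componentType H (φ v) = componentType G v := by
  refine (isoType_eq_of_iso (?_ : _ ≃g _)).symm
  exact
    { toEquiv := φ.toEquiv.subtypeEquiv fun w => by
        simp only [SimpleGraph.ConnectedComponent.mem_supp_iff, SimpleGraph.ConnectedComponent.eq]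
        exact φ.reachable_iff.symm
      map_rel_iff' := φ.map_adj_iff }

lemma componentType_of_preconnected {V : Type} {G : SimpleGraph V} (hG : G.Preconnected) (v : V) :
    componentType G v = isoType G := by
  have h : (G.connectedComponentMk v).supp = Set.univ := by
    ext w
    simpa [SimpleGraph.ConnectedComponent.eq] using hG w v
  unfold componentType
  rw [h]
  exact isoType_eq_of_iso (SimpleGraph.induceUnivIso G)

/-- The problem whose only solution labels every vertex by the isomorphism type of its
component. -/
def componentTypeProblem : GraphProblem where
  Label := Set (Σ k : ℕ, SimpleGraph (Fin k))
  solutions G := {componentType G}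

lemma componentTypeProblem_mem_ALL : componentTypeProblem ∈ ALL := by
  refine ⟨fun V W _ _ G H α => ?_, fun V _ G σ => ?_⟩
  · change {componentType G} = _
    ext τ
    have h : componentType G = componentType H ∘ α := funext fun v => (componentType_iso α v).symm
    rw [h]
    exact ⟨fun hτ => ⟨_, rfl, hτ⟩, fun ⟨_, hσ, hτ⟩ => by rw [hτ, hσ]; rfl⟩
  · change σ = componentType G ↔ ∀ c : G.ConnectedComponent,
      (fun u : c.supp => σ u) = componentType (G.induce c.supp)
    have key : ∀ (c : G.ConnectedComponent) (u : c.supp),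
        componentType (G.induce c.supp) u = componentType G u := by
      rintro c ⟨u, rfl⟩
      exact componentType_of_preconnected (G.connectedComponentMk u).connected_toSimpleGraph.1 _
    constructor
    · rintro rfl c
      exact funext fun u => (key c u).symm
    · intro h
      funext v
      have := congrFun (h (G.connectedComponentMk v)) ⟨v, rfl⟩
      rw [key] at this
      exact this

lemma HasCommonNeighbors.preconnected {V : Type*} {G : SimpleGraph V}
    (h : HasCommonNeighbors G) : G.Preconnected := by
  intro u v
  obtain ⟨w, hu, hv⟩ := h u v
  exact hu.reachable.trans hv.symm.reachable

/-! ### What a vertex sees in three rounds -/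

section View

open Classical

variable {V : Type} [Fintype V]

/-- The multiset of the degrees of the neighbors of a vertex. -/
noncomputable def neighborDegreeMultiset (G : SimpleGraph V) (w : V) : Multiset ℕ :=
  (G.neighborFinset w).val.map fun u => G.degree u

lemma card_neighborDegreeMultiset (G : SimpleGraph V) (w : V) :
    (neighborDegreeMultiset G w).card = G.degree w := by
  simp [neighborDegreeMultiset]

/-- After three rounds, the state of a vertex depends only on the edges at the vertex and its
neighbors, and on the multiset of the degrees of the neighbors of each vertex. -/
lemma Algorithm.stateAfter_three_eq {M : BroadcastModel} {Γ : Type} (A : Algorithm M Γ)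
    {G G' : SimpleGraph V} {v : V}
    (h1 : ∀ w, neighborDegreeMultiset G w = neighborDegreeMultiset G' w)
    (h2 : ∀ u, u = v ∨ G.Adj v u → G.neighborFinset u = G'.neighborFinset u) :
    A.stateAfter G 3 v = A.stateAfter G' 3 v := by
  have step : ∀ r w, A.stateAfter G r w = A.stateAfter G' r w →
      (G.neighborFinset w).val.filterMap (fun u => A.outgoing (A.stateAfter G r u)) =
        (G'.neighborFinset w).val.filterMap (fun u => A.outgoing (A.stateAfter G' r u)) →
      A.stateAfter G (r + 1) w = A.stateAfter G' (r + 1) w := by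
    intro r w hw hm
    simp only [Algorithm.stateAfter]
    rw [hw, hm]
  have hdeg : ∀ w, G.degree w = G'.degree w := fun w => by
    rw [← card_neighborDegreeMultiset, h1, card_neighborDegreeMultiset]
  have s0 : ∀ w, A.stateAfter G 0 w = A.stateAfter G' 0 w := fun w => by
    simp only [Algorithm.stateAfter]
    rw [hdeg]
  have s1 : ∀ w, A.stateAfter G 1 w = A.stateAfter G' 1 w := by
    intro w
    refine step 0 w (s0 w) ?_
    have e : ∀ H : SimpleGraph V, (H.neighborFinset w).val.filterMap
        (fun u => A.outgoing (A.stateAfter H 0 u)) = (neighborDegreeMultiset H w).filterMap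
          fun d => A.outgoing (A.init (Fintype.card V) d) := fun H => by
      rw [neighborDegreeMultiset, Multiset.filterMap_map]
      rfl
    rw [e, e, h1]
  -- States after one round agree everywhere. Two further rounds only need the neighborhoods of `v`
  -- and of its neighbors, which are the same in both graphs.
  have lift : ∀ r, ∀ w, w = v ∨ G.Adj v w →
      (∀ u, (u = w ∨ G.Adj w u) → A.stateAfter G r u = A.stateAfter G' r u) →
      A.stateAfter G (r + 1) w = A.stateAfter G' (r + 1) w := by
    intro r w hw hs
    refine step r w (hs w (Or.inl rfl)) ?_
    rw [← h2 w hw]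
    rw [Multiset.filterMap_eq_bind, Multiset.filterMap_eq_bind]
    refine Multiset.bind_congr fun u hu => ?_
    rw [hs u (Or.inr (by simpa using hu))]
  exact lift 2 v (Or.inl rfl) fun u hu => lift 1 u hu fun w _ => s1 w

end View

/-! ### Counting views -/

lemma card_simpleGraph_fin (n : ℕ) : Fintype.card (SimpleGraph (Fin n)) = 2 ^ n.choose 2 := by
  have h1 : ∀ s : Set (Sym2 (Fin n)), s ⊆ Sym2.diagSetᶜ →
      (SimpleGraph.fromEdgeSet s).edgeSet = s := fun s hs => by
    rw [SimpleGraph.edgeSet_fromEdgeSet]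
    exact sdiff_eq_left.2 (Set.subset_compl_iff_disjoint_right.1 hs)
  have e : SimpleGraph (Fin n) ≃ Set.powerset (Sym2.diagSetᶜ : Set (Sym2 (Fin n))) :=
    { toFun := fun G => ⟨G.edgeSet, G.edgeSet_subset_compl_diagSet⟩
      invFun := fun s => SimpleGraph.fromEdgeSet s.1
      left_inv := fun G => G.fromEdgeSet_edgeSet
      right_inv := fun s => Subtype.ext (h1 s.1 s.2) }
  rw [Fintype.card_eq_nat_card, Nat.card_congr e, Nat.card_coe_set_eq, Set.ncard_powerset _,
    ← Nat.card_coe_set_eq, ← Fintype.card_eq_nat_card, Sym2.card_diagSet_compl, Fintype.card_fin]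

lemma card_simpleGraph (V : Type*) [Fintype V] [DecidableEq V] :
    Fintype.card (SimpleGraph V) = 2 ^ (Fintype.card V).choose 2 := by
  rw [← card_simpleGraph_fin]
  exact Fintype.card_congr (Fintype.equivFin V).simpleGraph

section Counting

open Classical

variable {n : ℕ}

/-- The vertices other than `v` that are not adjacent to `v`. -/
noncomputable def nonNeighbors (G : SimpleGraph (Fin n)) (v : Fin n) : Finset (Fin n) :=
  (insert v (G.neighborFinset v))ᶜ

/-- The graph `G` without the edges inside `M`. -/
def deleteInside (G : SimpleGraph (Fin n)) (M : Finset (Fin n)) : SimpleGraph (Fin n) where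
  Adj a b := G.Adj a b ∧ ¬ (a ∈ M ∧ b ∈ M)
  symm := ⟨fun _ _ h => ⟨h.1.symm, fun h' => h.2 h'.symm⟩⟩
  loopless := ⟨fun a h => G.loopless.irrefl a h.1⟩

/-- Filling the empty set `M` with an arbitrary graph is injective, since the edges inside `M` give
back the filling. -/
lemma card_no_edges_inside_mul_le (M : Finset (Fin n)) :
    (Finset.univ.filter fun H : SimpleGraph (Fin n) => ∀ a ∈ M, ∀ b ∈ M, ¬ H.Adj a b).card *
      2 ^ M.card.choose 2 ≤ 2 ^ n.choose 2 := by
  have h : 2 ^ M.card.choose 2 = Fintype.card (SimpleGraph M) := by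
    rw [card_simpleGraph, Fintype.card_coe]
  rw [h, ← card_simpleGraph_fin n, ← Finset.card_univ, ← Finset.card_product, ← Finset.card_univ]
  refine Finset.card_le_card_of_injOn
    (fun x => x.1 ⊔ x.2.map (Function.Embedding.subtype _)) (fun _ _ => by simp) ?_
  rintro ⟨H, K⟩ h ⟨H', K'⟩ h' heq
  simp only [Finset.coe_product, Set.mem_prod, Finset.mem_coe, Finset.mem_filter, Finset.mem_univ,
    true_and, and_true] at h h'
  have hadj : ∀ a b, H.Adj a b ∨ (K.map (Function.Embedding.subtype _)).Adj a b ↔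
      H'.Adj a b ∨ (K'.map (Function.Embedding.subtype _)).Adj a b := by
    intro a b
    have := congrArg (fun G : SimpleGraph (Fin n) => G.Adj a b) heq
    simpa using this
  have hK : ∀ (K : SimpleGraph M) a b, (K.map (Function.Embedding.subtype _)).Adj a b ↔
      ∃ (ha : a ∈ M) (hb : b ∈ M), K.Adj ⟨a, ha⟩ ⟨b, hb⟩ := by
    intro K a b
    simp only [SimpleGraph.map_adj, Function.Embedding.subtype_apply]
    constructor
    · rintro ⟨⟨x, hx⟩, ⟨y, hy⟩, hxy, rfl, rfl⟩
      exact ⟨hx, hy, hxy⟩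
    · rintro ⟨ha, hb, hab⟩
      exact ⟨_, _, hab, rfl, rfl⟩
  have e1 : H = H' := by
    ext a b
    have := hadj a b
    rw [hK, hK] at this
    by_cases hab : a ∈ M ∧ b ∈ M
    · exact iff_of_false (h a hab.1 b hab.2) (h' a hab.1 b hab.2)
    · have hn : ∀ K : SimpleGraph M,
          ¬ ∃ (ha : a ∈ M) (hb : b ∈ M), K.Adj ⟨a, ha⟩ ⟨b, hb⟩ :=
        fun K ⟨ha, hb, _⟩ => hab ⟨ha, hb⟩
      simpa [hn] using this
  have e2 : K = K' := by
    ext ⟨a, ha⟩ ⟨b, hb⟩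
    have := hadj a b
    rw [hK, hK] at this
    simpa [h a ha b hb, h' a ha b hb, ha, hb] using this
  rw [e1, e2]

lemma card_filter_iso_le (G : SimpleGraph (Fin n)) :
    (Finset.univ.filter fun G' : SimpleGraph (Fin n) => Nonempty (G ≃g G')).card ≤
      n.factorial := by
  calc _ ≤ (Finset.univ.image fun e : Equiv.Perm (Fin n) => G.comap e.symm).card := by
        refine Finset.card_le_card fun G' h => ?_
        obtain ⟨φ⟩ := (Finset.mem_filter.1 h).2
        refine Finset.mem_image.2 ⟨φ.toEquiv, Finset.mem_univ _, ?_⟩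
        ext a b
        exact φ.symm.map_adj_iff
    _ ≤ _ := Finset.card_image_le.trans (by simp [Fintype.card_perm])

/-- If isomorphism types can be recognized from the three-round view of a vertex with at least `k`
non-neighbors, in graphs all of whose degrees lie in `W`, then there are few such graphs. -/
lemma card_mul_le_of_view (v : Fin n) (W : Finset ℕ) (k : ℕ) (S : Finset (SimpleGraph (Fin n)))
    (hW : ∀ G ∈ S, ∀ w, G.degree w ∈ W) (hk : ∀ G ∈ S, k ≤ (nonNeighbors G v).card)
    (hiso : ∀ G ∈ S, ∀ G' ∈ S,
      (∀ w, neighborDegreeMultiset G w = neighborDegreeMultiset G' w) →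
      (∀ u, u = v ∨ G.Adj v u → G.neighborFinset u = G'.neighborFinset u) → Nonempty (G ≃g G')) :
    S.card * 2 ^ k.choose 2 ≤
      2 ^ n * (n.factorial * ((n + 1) ^ (W.card * n)) * 2 ^ n.choose 2) := by
  have hN : ∀ N : Finset (Fin n), (S.filter fun G => G.neighborFinset v = N).card *
      2 ^ k.choose 2 ≤ n.factorial * ((n + 1) ^ (W.card * n)) * 2 ^ n.choose 2 := by
    intro N
    set T := S.filter fun G => G.neighborFinset v = N with hT
    rcases T.eq_empty_or_nonempty with he | ⟨G₀, hG₀⟩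
    · simp [he]
    set M : Finset (Fin n) := (insert v N)ᶜ with hM
    have hMN : ∀ G ∈ T, nonNeighbors G v = M := fun G hG => by
      rw [nonNeighbors, (Finset.mem_filter.1 hG).2]
    have hkM : k ≤ M.card := by
      rw [← hMN G₀ hG₀]
      exact hk G₀ (Finset.mem_filter.1 hG₀).1
    -- `f` encodes the view of `v`: the edges not inside `M`, and the neighbor-degree multisets
    -- through their multiplicities on `W`. Graphs with the same code are isomorphic, so each code
    -- has at most n! graphs.
    let f : SimpleGraph (Fin n) → SimpleGraph (Fin n) × (Fin n → W → Fin (n + 1)) :=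
      fun G => (deleteInside G M, fun w d => ⟨(neighborDegreeMultiset G w).count d.1, by
        have h1 := Multiset.count_le_card d.1 (neighborDegreeMultiset G w)
        rw [card_neighborDegreeMultiset] at h1
        have h2 := G.degree_lt_card_verts w
        rw [Fintype.card_fin] at h2
        omega⟩)
    have hf : ∀ G ∈ T, ∀ G' ∈ T, f G = f G' → Nonempty (G ≃g G') := by
      intro G hG G' hG' hff
      refine hiso G (Finset.mem_filter.1 hG).1 G' (Finset.mem_filter.1 hG').1 (fun w => ?_)
        fun u hu => ?_
      · ext d
        by_cases hd : d ∈ W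
        · have := congrFun (congrFun (congrArg Prod.snd hff) w) ⟨d, hd⟩
          exact congrArg Fin.val this
        · have hz : ∀ H ∈ T, (neighborDegreeMultiset H w).count d = 0 := by
            intro H hH
            rw [Multiset.count_eq_zero]
            intro hmem
            obtain ⟨u, _, rfl⟩ := Multiset.mem_map.1 hmem
            exact hd (hW H (Finset.mem_filter.1 hH).1 u)
          rw [hz G hG, hz G' hG']
      · have huM : u ∉ M := by
          rw [← hMN G hG]
          simpa only [nonNeighbors, Finset.mem_compl, Finset.mem_insert,
            SimpleGraph.mem_neighborFinset, not_not] using hu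
        ext x
        have := congrArg (fun H : SimpleGraph (Fin n) => H.Adj u x) (congrArg Prod.fst hff)
        simpa [f, deleteInside, huM] using this
    have h1 : T.card ≤ n.factorial * (T.image f).card := by
      refine Finset.card_le_mul_card_image T _ fun b hb => ?_
      obtain ⟨G, hG, rfl⟩ := Finset.mem_image.1 hb
      refine le_trans (Finset.card_le_card fun G' hG' => ?_) (card_filter_iso_le G)
      obtain ⟨hG'T, hG'f⟩ := Finset.mem_filter.1 hG'
      exact Finset.mem_filter.2 ⟨Finset.mem_univ _, hf G hG G' hG'T hG'f.symm⟩
    have h2 : (T.image f).card ≤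
        (Finset.univ.filter fun H : SimpleGraph (Fin n) =>
          ∀ a ∈ M, ∀ b ∈ M, ¬ H.Adj a b).card * (n + 1) ^ (W.card * n) := by
      have : Fintype.card (Fin n → W → Fin (n + 1)) = (n + 1) ^ (W.card * n) := by
        simp [pow_mul]
      rw [← this, ← Finset.card_univ, ← Finset.card_product]
      refine Finset.card_le_card fun b hb => ?_
      obtain ⟨G, hG, rfl⟩ := Finset.mem_image.1 hb
      refine Finset.mem_product.2 ⟨Finset.mem_filter.2 ⟨Finset.mem_univ _, ?_⟩, Finset.mem_univ _⟩
      exact fun a ha b hb hab => hab.2 ⟨ha, hb⟩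
    have h3 := card_no_edges_inside_mul_le M
    have h4 : 2 ^ k.choose 2 ≤ 2 ^ M.card.choose 2 :=
      Nat.pow_le_pow_right (by norm_num) (Nat.choose_le_choose 2 hkM)
    set c := (Finset.univ.filter fun H : SimpleGraph (Fin n) =>
      ∀ a ∈ M, ∀ b ∈ M, ¬ H.Adj a b).card with hc
    calc _ ≤ n.factorial * (c * (n + 1) ^ (W.card * n)) * 2 ^ M.card.choose 2 := by
          gcongr
          exact h1.trans (by gcongr)
      _ = n.factorial * (n + 1) ^ (W.card * n) * (c * 2 ^ M.card.choose 2) := by ring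
      _ ≤ _ := by gcongr
  calc _ = ∑ N : Finset (Fin n), (S.filter fun G => G.neighborFinset v = N).card *
        2 ^ k.choose 2 := by
        rw [← Finset.sum_mul, ← Finset.card_eq_sum_card_fiberwise (fun _ _ => by simp)]
    _ ≤ ∑ N : Finset (Fin n), n.factorial * ((n + 1) ^ (W.card * n)) * 2 ^ n.choose 2 :=
        Finset.sum_le_sum fun N _ => hN N
    _ = _ := by simp

end Counting

/-! ### Isomorphism types cannot be computed in three rounds -/

/-- A window that contains all degrees of almost all graphs with `n` vertices. -/
noncomputable def degreeWindow (n : ℕ) : Finset ℕ :=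
  Finset.Icc ((n - 2) / 2 + 1 - 2 * ⌈scale n ^ 11⌉₊) ((n - 2) / 2 + 2 * ⌈scale n ^ 11⌉₊)

lemma card_degreeWindow_le (n : ℕ) : (degreeWindow n).card ≤ 4 * ⌈scale n ^ 11⌉₊ := by
  unfold degreeWindow
  rw [Nat.card_Icc]
  omega

open Classical in
-- A union bound over both tails of each degree; complementing the random neighborhood reduces the
-- lower tail to the upper one.
lemma aas_degree_mem_degreeWindow : AAS fun n G => ∀ v, G.degree v ∈ degreeWindow n := by
  have hlim : Tendsto (fun n : ℕ => 2 * (scale n ^ 40 * Real.exp (-1 * scale n))) atTop (𝓝 0) := by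
    simpa using (tendsto_pow_mul_exp_neg_scale one_pos 40).const_mul 2
  refine AAS.of_le hlim ?_
  filter_upwards [eventually_ge_atTop 2, tendsto_scale.eventually_ge_atTop 1] with n hn hx
  set x := scale n with hxdef
  set u := ⌈x ^ 11⌉₊ with hu
  have hx0 : 0 < x := by linarith
  have hm2 : ((n - 2 : ℕ) : ℝ) + 2 = n := by
    rw [Nat.cast_sub hn]; push_cast; ring
  have hnt : Nontrivial (Fin n) := Fin.nontrivial_iff_two_le.2 hn
  set t := (n - 2) / 2 + 2 * u with ht
  have htail : binTail (n - 2) t ≤ x ^ 20 * Real.exp (-1 * x) := by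
    calc _ ≤ (((n - 2 : ℕ) : ℝ) + 1) * binPMF (n - 2) t := binTail_le (by omega)
      _ ≤ x ^ 20 * Real.exp (-x ^ 2) := by
          have := binPMF_nonneg (n - 2) t
          gcongr
          · rw [scale_pow]; linarith
          · exact binPMF_tail_le_exp hx0 (by rw [hm2, scale_pow]) (Nat.le_ceil _)
      _ ≤ _ := by
          gcongr
          nlinarith
  calc _ ≤ pr (fun G : SimpleGraph (Fin n) => ∃ v : Fin n,
        t + 1 ≤ G.degree v ∨ G.degree v + t ≤ n - 2) := by
        refine pr_mono fun G hG => ?_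
        contrapose! hG
        intro v
        have := hG v
        simp only [degreeWindow, Finset.mem_Icc, ← hxdef, ← hu]
        omega
    _ ≤ Fintype.card (Fin n) * (2 * binTail (n - 2) t) := by
        refine pr_exists_le_card_mul _ fun v => (pr_or_le _ _).trans ?_
        obtain ⟨w, hw⟩ := exists_ne v
        have h1 := pr_le_degree hw.symm t
        have h2 := pr_degree_add_le_le hw.symm t
        have h3 := binTail_eq_add (n - 2) t
        have h4 := binPMF_nonneg (n - 2) t
        rw [Fintype.card_fin] at h1 h2
        rw [h1]
        linarith
    _ ≤ x ^ 20 * (2 * (x ^ 20 * Real.exp (-1 * x))) := by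
        rw [Fintype.card_fin, hxdef, scale_pow, ← hxdef]
        gcongr
        rw [hxdef, ← scale_pow n, ← hxdef]
        exact htail
    _ = _ := by ring

/-- The counting bound for three-round views is far below the number of graphs. -/
lemma eventually_view_bound_lt : ∀ᶠ n : ℕ in atTop,
    2 * (2 ^ n * (n.factorial * (n + 1) ^ ((degreeWindow n).card * n))) <
      2 ^ (n / 4).choose 2 := by
  filter_upwards [eventually_ge_atTop 64, tendsto_scale.eventually_ge_atTop 144,
    eventually_pow_le_exp_scale 21] with n hn hx hexp
  set x := scale n with hxdef
  set u := ⌈x ^ 11⌉₊ with hu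
  have hx0 : 0 < x := by linarith
  have hx1 : 1 ≤ x := by linarith
  have hnx : (n : ℝ) = x ^ 20 := (scale_pow n).symm
  have hu2 : (u : ℝ) < x ^ 11 + 1 := Nat.ceil_lt_add_one (by positivity)
  have p11 : x ≤ x ^ 11 := by simpa using pow_le_pow_right₀ hx1 (show 1 ≤ 11 by norm_num)
  have h1 : 2 * (2 ^ n * (n.factorial * (n + 1) ^ ((degreeWindow n).card * n))) ≤
      (n + 1) ^ ((4 * u + 3) * n) := by
    calc _ ≤ (n + 1) ^ n * ((n + 1) ^ n * ((n + 1) ^ n * (n + 1) ^ (4 * u * n))) := by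
          have e1 : 2 ≤ (n + 1) ^ n :=
            (show 2 ≤ n + 1 by omega).trans (Nat.le_self_pow (by omega) _)
          have e2 : 2 ^ n ≤ (n + 1) ^ n := Nat.pow_le_pow_left (by omega) n
          have e3 : n.factorial ≤ (n + 1) ^ n :=
            (Nat.factorial_le_pow n).trans (Nat.pow_le_pow_left (by omega) n)
          have e4 : (n + 1) ^ ((degreeWindow n).card * n) ≤ (n + 1) ^ (4 * u * n) :=
            Nat.pow_le_pow_right (by omega) (Nat.mul_le_mul_right n (card_degreeWindow_le n))
          gcongr
      _ = _ := by ring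
  -- The exponent 32 is 11 + 20 + 1: the window size, the number of vertices, and log (n + 1) ≤ x.
  -- It is compared with order x ^ 40 = n ^ 2 hidden bits.
  have h2 : (((n + 1) ^ ((4 * u + 3) * n) : ℕ) : ℝ) ≤ Real.exp (11 * x ^ 32) := by
    have e1 : ((n : ℝ) + 1) ≤ Real.exp x := by
      refine le_trans ?_ hexp
      rw [hnx]
      have : 1 ≤ x ^ 20 := one_le_pow₀ hx1
      nlinarith
    push_cast
    calc ((n : ℝ) + 1) ^ ((4 * u + 3) * n) ≤ Real.exp x ^ ((4 * u + 3) * n) := by gcongr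
      _ = Real.exp (((4 * u + 3) * n : ℕ) * x) := by rw [Real.exp_nat_mul]
      _ ≤ _ := by
          rw [Real.exp_le_exp]
          push_cast
          rw [hnx]
          calc (4 * (u : ℝ) + 3) * x ^ 20 * x ≤ (11 * x ^ 11) * x ^ 20 * x := by
                gcongr
                linarith
            _ = _ := by ring
  have h3 : x ^ 40 / 64 ≤ ((n / 4).choose 2 : ℕ) := by
    rw [Nat.cast_choose_two]
    have e : (n : ℝ) / 4 - 1 ≤ ((n / 4 : ℕ) : ℝ) := by
      have : (n : ℝ) ≤ 4 * ((n / 4 : ℕ) : ℝ) + 3 := by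
        exact_mod_cast (by omega : n ≤ 4 * (n / 4) + 3)
      linarith
    have hn' : (64 : ℝ) ≤ n := by exact_mod_cast hn
    have e40 : x ^ 40 = (n : ℝ) ^ 2 := by rw [hnx]; ring
    rw [e40]
    nlinarith
  have h4 : Real.exp (11 * x ^ 32) < 2 ^ ((n / 4).choose 2) := by
    rw [← Real.rpow_natCast 2, Real.rpow_def_of_pos two_pos, Real.exp_lt_exp]
    have l2 : (1 / 2 : ℝ) < Real.log 2 := by linarith [Real.log_two_gt_d9]
    have e8 : x ≤ x ^ 7 := by simpa using pow_le_pow_right₀ hx1 (show 1 ≤ 7 by norm_num)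
    have e9 : (144 : ℝ) * 144 ≤ x ^ 8 := by
      calc (144 : ℝ) * 144 ≤ x * x ^ 7 := by gcongr; linarith
        _ = _ := by ring
    calc 11 * x ^ 32 < x ^ 8 / 128 * x ^ 32 := by
          gcongr
          linarith
      _ = 1 / 2 * (x ^ 40 / 64) := by ring
      _ ≤ _ := by gcongr
  have h5 : (((n + 1) ^ ((4 * u + 3) * n) : ℕ) : ℝ) < ((2 ^ (n / 4).choose 2 : ℕ) : ℝ) := by
    refine h2.trans_lt ?_
    push_cast
    exact h4
  exact h1.trans_lt (by exact_mod_cast h5)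

open Classical in
lemma eventually_le_card_nonNeighbors : ∀ᶠ n : ℕ in atTop, ∀ (G : SimpleGraph (Fin n)) (v : Fin n),
    (∀ w, G.degree w ∈ degreeWindow n) →
      n / 4 ≤ (nonNeighbors G v).card := by
  filter_upwards [eventually_ge_atTop 64, tendsto_scale.eventually_ge_atTop 144] with n hn hx G v h
  set x := scale n with hxdef
  set u := ⌈x ^ 11⌉₊ with hu
  have hx0 : 0 < x := by linarith
  have hx1 : 1 ≤ x := by linarith
  have hnx : (n : ℝ) = x ^ 20 := (scale_pow n).symm
  have hu2 : (u : ℝ) < x ^ 11 + 1 := Nat.ceil_lt_add_one (by positivity)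
  have hun : 16 * u ≤ n := by
    have p11 : x ≤ x ^ 11 := by simpa using pow_le_pow_right₀ hx1 (show 1 ≤ 11 by norm_num)
    have p9 : x ≤ x ^ 9 := by simpa using pow_le_pow_right₀ hx1 (show 1 ≤ 9 by norm_num)
    have : (16 : ℝ) * u ≤ n := by
      calc (16 : ℝ) * u ≤ 144 * x ^ 11 := by linarith
        _ ≤ x ^ 9 * x ^ 11 := by gcongr; linarith
        _ = n := by rw [hnx]; ring
    exact_mod_cast this
  have hd := (Finset.mem_Icc.1 (h v)).2
  rw [← hxdef, ← hu] at hd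
  have hc := Finset.card_insert_le v (G.neighborFinset v)
  rw [SimpleGraph.card_neighborFinset_eq_degree] at hc
  rw [nonNeighbors, Finset.card_compl, Fintype.card_fin]
  omega

lemma componentTypeProblem_notMem (M : BroadcastModel) :
    componentTypeProblem ∉ nonuniformSound M 3 := by
  classical
  rintro ⟨-, A, hA⟩
  have haas := (hA.solves.and aas_hasCommonNeighbors).and aas_degree_mem_degreeWindow
  have hhalf : ∀ᶠ n in atTop, (1 / 2 : ℝ) < randomGraphProb n _ :=
    haas.eventually_const_lt (by norm_num)
  obtain ⟨n, hprob, hbound, hnon, hn⟩ := (hhalf.and (eventually_view_bound_lt.and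
    (eventually_le_card_nonNeighbors.and (eventually_ge_atTop 1)))).exists
  have hne : NeZero n := ⟨by omega⟩
  let v : Fin n := 0
  set S : Finset (SimpleGraph (Fin n)) := Finset.univ.filter fun G =>
    (A.SolvesOn G 3 ∧ HasCommonNeighbors G) ∧ ∀ w, G.degree w ∈ degreeWindow n with hS
  have hmem : ∀ G ∈ S, (A.SolvesOn G 3 ∧ HasCommonNeighbors G) ∧
      ∀ w, G.degree w ∈ degreeWindow n := fun G hG => (Finset.mem_filter.1 hG).2
  -- More than half of all graphs are solved, have common neighbors and have all degrees in the
  -- window.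
  have hcard : 2 ^ n.choose 2 < 2 * S.card := by
    rw [randomGraphProb_eq_pr, pr_def, card_simpleGraph_fin, lt_div_iff₀ (by positivity)] at hprob
    have h2 : (2 : ℝ) ^ n.choose 2 < 2 * S.card := by
      push_cast at hprob
      have e : (S.card : ℝ) = ((Finset.univ.filter fun G : SimpleGraph (Fin n) =>
          (A.SolvesOn G 3 ∧ HasCommonNeighbors G) ∧
            ∀ w, G.degree w ∈ degreeWindow n).card : ℝ) := by rw [hS]
      rw [e]
      linarith
    exact_mod_cast h2
  have hview := card_mul_le_of_view v (degreeWindow n) (n / 4) S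
    (fun G hG => by convert (hmem G hG).2)
    (fun G hG => hnon G v fun w => by convert (hmem G hG).2 w)
    (fun G hG G' hG' h1 h2 => by
      obtain ⟨σ, hσ, hout⟩ := (hmem G hG).1.1
      obtain ⟨σ', hσ', hout'⟩ := (hmem G' hG').1.1
      have e1 := hout v
      have e2 := hout' v
      rw [A.stateAfter_three_eq h1 h2, e2] at e1
      have e3 : σ' v = σ v := by
        simpa using e1
      have hσ : σ = componentType G := hσ
      have hσ' : σ' = componentType G' := hσ'
      rw [hσ, hσ', componentType_of_preconnected (hmem G hG).1.2.preconnected,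
        componentType_of_preconnected (hmem G' hG').1.2.preconnected] at e3
      have : (⟨n, G⟩ : Σ k, SimpleGraph (Fin k)) ∈ isoType G := ⟨SimpleGraph.Iso.refl⟩
      rw [← e3] at this
      exact this)
  have hpos : 0 < 2 ^ n.choose 2 := by positivity
  have : 2 ^ n.choose 2 * 2 ^ (n / 4).choose 2 < 2 ^ n.choose 2 * 2 ^ (n / 4).choose 2 := by
    calc _ ≤ 2 * S.card * 2 ^ (n / 4).choose 2 := by gcongr
      _ = 2 * (S.card * 2 ^ (n / 4).choose 2) := by ring
      _ ≤ 2 * (2 ^ n * (n.factorial * ((n + 1) ^ ((degreeWindow n).card * n)) *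
          2 ^ n.choose 2)) := by gcongr
      _ = 2 ^ n.choose 2 * (2 * (2 ^ n * (n.factorial *
          (n + 1) ^ ((degreeWindow n).card * n)))) := by ring
      _ < _ := by gcongr
  exact lt_irrefl _ this

theorem mainTheorem4 :
    solvableALL = nonuniformSound SB 4 ∧
    (nonuniformSound MB 3 ⊂ solvableALL ∧
      ∃ P : GraphProblem, P ∈ ALL ∧
        (∀ (V : Type) [Finite V] (G : SimpleGraph V), (P.solutions G).Nonempty) ∧
        P ∉ nonuniformSound MB 3) := by
  have hne : ∀ (V : Type) [Finite V] (G : SimpleGraph V),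
      (componentTypeProblem.solutions G).Nonempty := fun V _ G => ⟨_, rfl⟩
  have hmem : componentTypeProblem ∈ solvableALL := by
    refine ⟨componentTypeProblem_mem_ALL, AAS.of_le tendsto_const_nhds (.of_forall fun n => ?_)⟩
    simp [pr, hne]
  have hnot := componentTypeProblem_notMem MB
  refine ⟨solvableALL_eq_nonuniformSound_SB,
    ⟨nonuniformSound_subset_solvableALL MB 3, fun h => hnot (h hmem)⟩,
    componentTypeProblem, componentTypeProblem_mem_ALL, hne, hnot⟩
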